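/- **Theorem 1 (HS-CAI is complete).** *Setting.* A DCOP consists of finitely many agents $a_i$, each holding one variable $x_i$ with a finite non-empty ordered domain $D_i$, and of binary constraints $f_{ij}:D_i\times D_j\to\mathbb R_{\ge 0}$, one for every edge of a constraint graph. A solution is optimal if it minimizes the sum of all $f_{ij}$ over all complete assignments. A pseudo tree is a rooted spanning tree of the constraint graph, with edges from the graph, such that the two ends of each constraint lie on one branch. $P(a_i)$ is the parent of $a_i$, $C(a_i)$ the set of its children, $AP(a_i)$ the set of its ancestors that share a constraint with it, and $localUtil_i=\sum_{a_j\in AP(a_i)}f_{ij}$. The parameters are a dimension limit $k\in\mathbb N$ and a threshold $t\in\mathbb R$. Agents exchange messages with parent and children over reliable first-in-first-out channels with arbitrary finite delays; each agent reacts to one message at a time. *HS-CAI, preprocessing.* Bottom-up, each non-root $a_i$ joins $localUtil_i$ with the utilities $preUtil_i^c$ of its children, lets $S_i$ consist of all dimensions other than $x_i$ except the $k$ lowest ones in the tree, and sends to $P(a_i)$ the approximated dimensions $SList_i=S_i\cup\bigcup_c SList_i^c$ and the utility $\min_{S_i\cup\{x_i\}}(localUtil_i\otimes\bigotimes_c preUtil_i^c)$.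 Then the root starts the search under the empty current partial assignment (CPA), with context evaluation switched on. *Search.* On receiving a CPA, $a_i$ sets, for each child $a_c$ and $d\in D_i$, the lower bound $lb_i^c(d)$ to the value at $Cpa_i\cup\{(x_i,d)\}$ of the last context-based utility received from $a_c$ if its pattern is compatible with $Cpa_i$, and of $preUtil_i^c$ otherwise. Each branch $a_c$ explores, one after the other, the values $d$ for which the local cost plus $\sum_{c}lb_i^{c}(d)$ is less than the current upper bound, by a message with $Cpa_i\cup\{(x_i,d)\}$ and the evaluation flag; different branches may explore different values at the same time. The upper bound is the minimum of the bound received with the CPA and the best cost found under this CPA. The bound handed down to $a_c$ is either always $\infty$, or always the upper bound less the local cost and the lower bounds of the other branches. When a branch returns, $lb_i^c(d)$ is replaced by the cost returned ($\infty$ if there is no solution below the bound handed down) and the branch goes on to its next value. When no branch is being explored, $a_i$ backtracks with its best solution of the sub-tree and its cost, if that cost is below the bound received; the root instead returns its best solution and sends it down the tree, and an agent terminates when it holds it. *Context-based inference.* For each dimension, $a_i$ counts the successive CPAs that assign it the same value. A pattern incompatible with a new CPA is discarded. If the flag received is on and $a_i$ has no pattern, it takes as pattern all assignments $(x_j,Cpa_i(x_j))$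 with $x_j\in SList_i$ whose count exceeds $t$. If this is non-empty, $a_i$ sends each child its part of the pattern (the assignments to $SList_i^c$), if non-empty. The flag is off while $a_i$ has a pattern. On receiving a pattern, $a_i$ adopts it, switches the flag off and passes on the parts in the same way; when the children concerned have answered (at once if there are none), it answers $P(a_i)$ with the pattern and the following utility: $localUtil_i$ joined with the new utilities of these children and the preprocessing utilities of the others, with the assigned dimensions of $S_i$ fixed and the other dimensions of $S_i$ and $x_i$ minimized out. *Claim.* For every DCOP, every pseudo tree of it and all parameters, HS-CAI is complete: it always terminates, i.e. there is no infinite execution, and it returns an optimal solution, i.e. in every execution that cannot be continued all agents have terminated, all holding one and the same complete assignment, which is an optimal solution of the DCOP. -/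

import Mathlib

open scoped ENNReal NNReal Classical

namespace HSCAI

universe u v

/-! ### The problem -/

/-- A DCOP with one variable per agent and binary constraints. Agents (= variables) are the elements
of `V`, the domain of `i` is `D i`; there is a constraint `f i j` for every edge of the constraint
graph, and `f i j`, `f j i` are the same constraint read from its two ends. -/
structure DCOP (V : Type u) (D : V → Type v) where
  graph : SimpleGraph V
  f : (i j : V) → D i → D j → ℝ≥0
  symm : ∀ i j a b, f i j a b = f j i b a

/-- A rooted spanning tree of the constraint graph (`parent`, with tree edges taken from the graph)
such that the ends of every constraint lie on one branch. `TransGen … v u` reads: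
`u` is a proper ancestor of `v`. -/
structure PseudoTree {V : Type u} (G : SimpleGraph V) where
  root : V
  parent : V → Option V
  parent_root : parent root = none
  reaches_root : ∀ v, Relation.ReflTransGen (fun a b => parent a = some b) v root
  parent_adj : ∀ v p, parent v = some p → G.Adj v p
  same_branch : ∀ u v, G.Adj u v →
    Relation.TransGen (fun a b => parent a = some b) v u ∨
    Relation.TransGen (fun a b => parent a = some b) u v

/-- The data of a run: problem, pseudo tree, dimension limit `k`, frequency threshold `t`, and
whether a CPA message also hands down an upper bound for the branch (plain tree-based branch and
bound if `false`). -/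
structure Setup (V : Type u) (D : V → Type v) where
  dcop : DCOP V D
  tree : PseudoTree dcop.graph
  k : ℕ
  t : ℝ
  shareBound : Bool

/-- A set of assignments `(x_j, d_j)`. -/
abbrev Asg (V : Type u) (D : V → Type v) := Set (Σ j : V, D j)

/-- The complete assignment `σ` as a set of pairs. -/
def asg {V : Type u} {D : V → Type v} (σ : ∀ j, D j) : Asg V D := Set.range fun j => ⟨j, σ j⟩

section Problem

variable {V : Type u} {D : V → Type v} [Fintype V]

/-- The global cost, one summand for every constraint. -/
noncomputable def DCOP.cost (P : DCOP V D) (σ : ∀ j, D j) : ℝ≥0 :=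
  ∑ e ∈ P.graph.edgeFinset,
    Sym2.lift ⟨fun i j => P.f i j (σ i) (σ j), fun i j => P.symm i j (σ i) (σ j)⟩ e

def DCOP.IsOptimal (P : DCOP V D) (σ : ∀ j, D j) : Prop := ∀ τ, P.cost σ ≤ P.cost τ

/-- `j` is a proper ancestor of `i`. -/
def Setup.Anc (H : Setup V D) (j i : V) : Prop :=
  Relation.TransGen (fun a b => H.tree.parent a = some b) i j

/-- The children `C(a_i)`. -/
noncomputable def Setup.children (H : Setup V D) (i : V) : Finset V :=
  Finset.univ.filter fun c => H.tree.parent c = some i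

/-- The parent and pseudo parents `AP(a_i)`. -/
noncomputable def Setup.allParents (H : Setup V D) (i : V) : Finset V :=
  Finset.univ.filter fun j => H.dcop.graph.Adj i j ∧ H.Anc j i

end Problem

/-! ### Utilities -/

/-- A utility: its dimensions, and its value as a function of the complete assignment (which it
reads only on its dimensions). -/
structure Util (V : Type u) (D : V → Type v) where
  dims : Finset V
  val : (∀ j, D j) → ℝ≥0∞

namespace Util

variable {V : Type u} {D : V → Type v}

/-- The combination `⊗` of a base utility with a finite family. -/
noncomputable def join (w : Util V D) (s : Finset V) (g : V → Util V D) : Util V D where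
  dims := w.dims ∪ s.biUnion fun c => (g c).dims
  val σ := w.val σ + ∑ c ∈ s, (g c).val σ

/-- Minimize out the dimensions in `S`. -/
noncomputable def minOut (S : Finset V) (w : Util V D) : Util V D where
  dims := w.dims \ S
  val σ := ⨅ τ : ∀ j, D j, ⨅ _ : ∀ j, j ∉ S → τ j = σ j, w.val τ

/-- Fix the values of the dimensions assigned by `A`. -/
noncomputable def fix (A : Asg V D) (w : Util V D) : Util V D where
  dims := w.dims.filter fun j => ∀ d : D j, (⟨j, d⟩ : Σ j, D j) ∉ A
  val σ := w.val fun j => if h : ∃ d : D j, (⟨j, d⟩ : Σ j, D j) ∈ A then h.choose else σ j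

/-- The value at a partial assignment `A`. All dimensions of a utility are assigned by `A` wherever
this is used, and then all complete extensions of `A` give the same value. -/
noncomputable def at' (w : Util V D) (A : Asg V D) : ℝ≥0∞ :=
  ⨅ σ : ∀ j, D j, ⨅ _ : A ⊆ asg σ, w.val σ

end Util

/-! ### Messages and agent states -/

inductive Msg (V : Type u) (D : V → Type v) where
  /-- preprocessing: approximated dimensions and utility, child to parent -/
  | preUtil (slist : Finset V) (w : Util V D)
  /-- current partial assignment, upper bound for the branch, context evaluation flag -/
  | cpa (pa : Asg V D) (ub : ℝ≥0∞) (eval : Bool)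
  /-- a context pattern, parent to child -/
  | ctxt (p : Asg V D)
  /-- a context-based utility and the pattern it was computed for, child to parent -/
  | ctxtUtil (p : Asg V D) (w : Util V D)
  /-- cost and assignment of a best solution of the branch, or `none` if there is no solution of
  cost below the upper bound -/
  | backtrack (r : Option (ℝ≥0∞ × Asg V D))
  /-- the final solution, parent to child -/
  | terminate (A : Asg V D)

/-- The local memory of agent `i`. -/
structure State (V : Type u) (D : V → Type v) (i : V) where
  /-- `(SList_i^c, preUtil_i^c)` as received from the child `c` -/
  pre : V → Option (Finset V × Util V D)
  /-- the solution returned; the agent has terminated once it is set -/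
  result : Option (Asg V D)
  cpa : Asg V D
  /-- the upper bound that came with `cpa` -/
  ub : ℝ≥0∞
  eval : Bool
  /-- the number of successive CPAs with the present assignment of a dimension -/
  cnt : V → ℕ
  /-- the context pattern; empty if there is none -/
  ctxt : Asg V D
  /-- whether `ctxt` was found by the agent itself -/
  starter : Bool
  /-- the last context-based utility received from a child, with its pattern -/
  ctxtUtil : V → Option (Asg V D × Util V D)
  /-- `lb_i^c(d_i)`; replaced by the cost of the branch when that is known -/
  lb : V → D i → ℝ≥0∞
  /-- best solution of the branch `c` for the value `d_i`, when known -/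
  sol : V → D i → Option (Asg V D)
  /-- values already sent to a child since the present CPA arrived -/
  tried : V → Finset (D i)
  /-- the value now being explored in a branch -/
  cur : V → Option (D i)

/-- Memory before any communication. -/
def State.initial (V : Type u) (D : V → Type v) (i : V) : State V D i where
  pre _ := none
  result := none
  cpa := ∅
  ub := ⊤
  eval := false
  cnt _ := 0
  ctxt := ∅
  starter := false
  ctxtUtil _ := none
  lb _ _ := 0
  sol _ _ := none
  tried _ := ∅
  cur _ := none

/-- Messages to be sent, by addressee. -/
abbrev Out (V : Type u) (D : V → Type v) := V → List (Msg V D)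

section Algorithm

variable {V : Type u} {D : V → Type v} [Fintype V] [∀ j, Fintype (D j)] [∀ j, LinearOrder (D j)]
variable (H : Setup V D) {i : V}

/-! ### Preprocessing phase -/

/-- `localUtil_i`. -/
noncomputable def localUtil (i : V) : Util V D where
  dims := insert i (H.allParents i)
  val σ := ∑ j ∈ H.allParents i, (H.dcop.f i j (σ i) (σ j) : ℝ≥0∞)

/-- `SList_i^c`. -/
def childSList (s : State V D i) (c : V) : Finset V := ((s.pre c).map Prod.fst).getD ∅

/-- `preUtil_i^c`. -/
def childPre (s : State V D i) (c : V) : Util V D := ((s.pre c).map Prod.snd).getD ⟨∅, fun _ => 0⟩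

/-- `localUtil_i ⊗ (⊗_c preUtil_i^c)`. -/
noncomputable def preJoin (s : State V D i) : Util V D :=
  (localUtil H i).join (H.children i) (childPre s)

/-- `S_i`: of the dimensions other than `x_i`, all but the `k` lowest ones in the tree. -/
noncomputable def dropped (s : State V D i) : Finset V :=
  ((preJoin H s).dims.erase i).filter fun j =>
    H.k ≤ (((preJoin H s).dims.erase i).filter fun l => H.Anc j l).card

/-- `SList_i`. -/
noncomputable def slist (s : State V D i) : Finset V :=
  dropped H s ∪ (H.children i).biUnion (childSList s)

/-- The utility sent to the parent in the preprocessing phase. -/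
noncomputable def preOut (s : State V D i) : Util V D :=
  (preJoin H s).minOut (insert i (dropped H s))

/-! ### Context-based inference -/

/-- `ctxt_i^c`, the part of the pattern allocated to the child `c`. -/
def alloc (s : State V D i) (c : V) : Asg V D := {p ∈ s.ctxt | p.1 ∈ childSList s c}

/-- `inferChild_i`. -/
noncomputable def inferChild (s : State V D i) : Finset V :=
  (H.children i).filter fun c => (alloc s c).Nonempty

/-- CTXT messages to `inferChild_i`. -/
noncomputable def allocate (s : State V D i) : Out V D :=
  fun c => if c ∈ inferChild H s then [Msg.ctxt (alloc s c)] else []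

/-- The context-based utility sent to the parent: join, fix the dimensions of `S_i` that the pattern
assigns, minimize out the other dimensions of `S_i` and `x_i`. -/
noncomputable def ctxtOut (s : State V D i) : Util V D :=
  (((localUtil H i).join (H.children i) fun c =>
      if c ∈ inferChild H s then ((s.ctxtUtil c).map Prod.snd).getD (childPre s c)
      else childPre s c).fix {p ∈ s.ctxt | p.1 ∈ dropped H s}).minOut
    (insert i ((dropped H s).filter fun j => ∀ d : D j, (⟨j, d⟩ : Σ j, D j) ∉ s.ctxt))

/-- `c` has answered the pattern now allocated to it. -/
def Answered (s : State V D i) (c : V) : Prop := ∃ w, s.ctxtUtil c = some (alloc s c, w)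

/-- `lb_i^c(d)` from the stored context-based utility if its pattern is compatible with the CPA,
else from the preprocessing utility. -/
noncomputable def initLB (s : State V D i) (c : V) (d : D i) : ℝ≥0∞ :=
  match s.ctxtUtil c with
  | some (p, w) => if p ⊆ s.cpa then w.at' (insert ⟨i, d⟩ s.cpa)
      else (childPre s c).at' (insert ⟨i, d⟩ s.cpa)
  | none => (childPre s c).at' (insert ⟨i, d⟩ s.cpa)

/-! ### Search part -/

/-- Nothing to send. -/
def silent : Out V D := fun _ => []

/-- Send `m` to `p` only. -/
noncomputable def sendTo (p : V) (m : Msg V D) : Out V D := fun j => if j = p then [m] else []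

/-- Send `m` to the parent, if there is one. -/
noncomputable def sendParent (i : V) (m : Msg V D) : Out V D :=
  match H.tree.parent i with
  | some p => sendTo p m
  | none => silent

/-- Lower bound for the cost of the sub-tree rooted at `i` under the CPA and `x_i = d`. -/
noncomputable def bound (s : State V D i) (d : D i) : ℝ≥0∞ :=
  (localUtil H i).at' (insert ⟨i, d⟩ s.cpa) + ∑ c ∈ H.children i, s.lb c d

/-- All branches have returned a solution for `d` (so `bound` is a cost). -/
def Complete (s : State V D i) (d : D i) : Prop := ∀ c ∈ H.children i, s.sol c d ≠ none

/-- The current upper bound: the one received, or the best cost found under the present CPA. -/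
noncomputable def upper (s : State V D i) : ℝ≥0∞ :=
  s.ub ⊓ ⨅ d : D i, ⨅ _ : Complete H s d, bound H s d

/-- The best solution of the sub-tree found, if its cost is below the upper bound received. -/
noncomputable def best (s : State V D i) : Option (ℝ≥0∞ × Asg V D) :=
  let M : Finset (D i) := Finset.univ.filter fun d =>
    Complete H s d ∧ bound H s d < s.ub ∧ bound H s d = upper H s
  if h : M.Nonempty then
    some (upper H s, insert ⟨i, M.min' h⟩ (⋃ c ∈ H.children i, (s.sol c (M.min' h)).getD ∅))
  else none

/-- The first value that has not been tried in branch `c` and is not pruned. -/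
noncomputable def nextVal (s : State V D i) (c : V) : Option (D i) :=
  let M : Finset (D i) := Finset.univ.filter fun d => d ∉ s.tried c ∧ bound H s d < upper H s
  if h : M.Nonempty then some (M.min' h) else none

/-- The upper bound handed down to `c` with the value `d`. -/
noncomputable def childBound (s : State V D i) (c : V) (d : D i) : ℝ≥0∞ :=
  if H.shareBound then
    upper H s - ((localUtil H i).at' (insert ⟨i, d⟩ s.cpa)
      + ∑ c' ∈ (H.children i).erase c, s.lb c' d)
  else ⊤

/-- Let each of the branches `cs` explore its next value. -/
noncomputable def advance (s : State V D i) (cs : Finset V) : State V D i × Out V D :=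
  ({ s with
      cur := fun c => if c ∈ cs then nextVal H s c else s.cur c
      tried := fun c => if c ∈ cs then s.tried c ∪ (nextVal H s c).toFinset else s.tried c },
    fun c => if c ∈ cs then
      (match nextVal H s c with
       | some d => [Msg.cpa (insert ⟨i, d⟩ s.cpa) (childBound H s c d) s.eval]
       | none => [])
      else [])

/-- If no branch is being explored any more: backtrack to the parent; the root returns its best
solution and terminates. -/
noncomputable def conclude (s : State V D i) : State V D i × Out V D :=
  if ∀ c ∈ H.children i, s.cur c = none then
    if i = H.tree.root then
      match best H s with
      | some (_, A) => ({ s with result := some A },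
          fun c => if c ∈ H.children i then [Msg.terminate A] else [])
      | none => (s, silent)
    else (s, sendParent H i (Msg.backtrack (best H s)))
  else (s, silent)

noncomputable def explore (s : State V D i) (cs : Finset V) : State V D i × Out V D :=
  ((conclude H (advance H s cs).1).1,
    fun j => (advance H s cs).2 j ++ (conclude H (advance H s cs).1).2 j)

/-- Begin the search under the CPA just stored. -/
noncomputable def startSearch (s : State V D i) : State V D i × Out V D :=
  explore H { s with lb := initLB s, sol := fun _ _ => none,
                     tried := fun _ => ∅, cur := fun _ => none } (H.children i)

/-! ### Reactions of an agent -/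

/-- Once the preprocessing utilities of all children are there: send one's own to the parent; the
root starts the search, with context evaluation switched on. -/
noncomputable def preprocess (s : State V D i) : State V D i × Out V D :=
  if ∀ c ∈ H.children i, s.pre c ≠ none then
    if i = H.tree.root then startSearch H { s with cpa := ∅, ub := ⊤, eval := true }
    else (s, sendParent H i (Msg.preUtil (slist H s) (preOut H s)))
  else (s, silent)

/-- Counters after the CPA `pa` has arrived: one more if the assignment of the dimension is the same
as in the previous CPA, otherwise restarted. -/
noncomputable def newCnt (s : State V D i) (pa : Asg V D) (j : V) : ℕ :=
  if ∃ d : D j, (⟨j, d⟩ : Σ j, D j) ∈ pa ∧ (⟨j, d⟩ : Σ j, D j) ∈ s.cpa then s.cnt j + 1 else 1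

/-- The pattern kept when `pa` arrives: it is discarded if it is incompatible with `pa`. -/
noncomputable def keptCtxt (s : State V D i) (pa : Asg V D) : Asg V D :=
  if s.ctxt ⊆ pa then s.ctxt else ∅

/-- The assignments of `pa` to approximated dimensions that are more frequent than `t`. -/
noncomputable def frequent (s : State V D i) (pa : Asg V D) : Asg V D :=
  {p ∈ pa | p.1 ∈ slist H s ∧ H.t < (newCnt s pa p.1 : ℝ)}

/-- The agent finds a new pattern. -/
def Finds (s : State V D i) (pa : Asg V D) (ev : Bool) : Prop :=
  ev = true ∧ keptCtxt s pa = ∅ ∧ (frequent H s pa).Nonempty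

/-- Memory after a CPA has been stored, counters updated and the context evaluated. -/
noncomputable def storeCpa (s : State V D i) (pa : Asg V D) (ub : ℝ≥0∞) (ev : Bool) :
    State V D i :=
  { s with
    cpa := pa
    ub := ub
    cnt := newCnt s pa
    ctxt := if Finds H s pa ev then frequent H s pa else keptCtxt s pa
    starter := if Finds H s pa ev then true else s.starter
    eval := ev && decide (¬ Finds H s pa ev ∧ keptCtxt s pa = ∅) }

noncomputable def onCpa (s : State V D i) (pa : Asg V D) (ub : ℝ≥0∞) (ev : Bool) :
    State V D i × Out V D :=
  ((startSearch H (storeCpa H s pa ub ev)).1,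
    fun j => (if Finds H s pa ev then allocate H (storeCpa H s pa ub ev) j else [])
      ++ (startSearch H (storeCpa H s pa ub ev)).2 j)

/-- A pattern arrives: pass it on to the children concerned; if there are none, answer it. -/
noncomputable def onCtxt (s : State V D i) (p : Asg V D) : State V D i × Out V D :=
  let s' : State V D i := { s with ctxt := p, starter := false, eval := false }
  (s', if inferChild H s' = ∅ then sendParent H i (Msg.ctxtUtil p (ctxtOut H s'))
       else allocate H s')

/-- A context-based utility arrives: store it; when it is the last one needed for the present
pattern and that pattern came from the parent, answer the parent. -/
noncomputable def onCtxtUtil (s : State V D i) (c : V) (p : Asg V D) (w : Util V D) :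
    State V D i × Out V D :=
  let s' : State V D i := { s with ctxtUtil := Function.update s.ctxtUtil c (some (p, w)) }
  (s', if s'.starter = false ∧ c ∈ inferChild H s' ∧ ∀ c' ∈ inferChild H s', Answered s' c'
       then sendParent H i (Msg.ctxtUtil s'.ctxt (ctxtOut H s')) else silent)

/-- Branch `c` returns: record cost (`⊤` if there is nothing below its upper bound) and solution,
then let the branch explore its next value. -/
noncomputable def onBacktrack (s : State V D i) (c : V) (r : Option (ℝ≥0∞ × Asg V D)) :
    State V D i × Out V D :=
  match s.cur c with
  | none => (s, silent)
  | some d => explore H { s with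
      lb := fun c' d' => if c' = c ∧ d' = d then (r.map Prod.fst).getD ⊤ else s.lb c' d'
      sol := fun c' d' => if c' = c ∧ d' = d then r.map Prod.snd else s.sol c' d' } {c}

/-- Reaction of agent `i` to a message from `src`. A terminated agent ignores all messages. -/
noncomputable def handle (s : State V D i) (src : V) (m : Msg V D) : State V D i × Out V D :=
  if s.result ≠ none then (s, silent) else
  match m with
  | .preUtil sl w => preprocess H { s with pre := Function.update s.pre src (some (sl, w)) }
  | .cpa pa ub ev => onCpa H s pa ub ev
  | .ctxt p => onCtxt H s p
  | .ctxtUtil p w => onCtxtUtil H s src p w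
  | .backtrack r => onBacktrack H s src r
  | .terminate A => ({ s with result := some A },
      fun c => if c ∈ H.children i then [Msg.terminate A] else [])

/-! ### Executions -/

/-- The agents' memories and the messages in transit; `chan a b` is the queue from `a` to `b`. -/
structure Config (V : Type u) (D : V → Type v) where
  state : (i : V) → State V D i
  chan : V → V → List (Msg V D)

/-- Every agent has made its first move: the leaves of the tree have sent their preprocessing
utilities (a root without children has already solved the problem). -/
noncomputable def start : Config V D where
  state i := (preprocess H (State.initial V D i)).1
  chan a b := (preprocess H (State.initial V D a)).2 b

/-- The configuration after `b` has handled `m`, the first message of the queue from `a` to `b`,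
where `rest` is what remains of that queue. -/
noncomputable def deliver (γ : Config V D) (a b : V) (m : Msg V D) (rest : List (Msg V D)) :
    Config V D where
  state := Function.update γ.state b (handle H (γ.state b) a m).1
  chan x y :=
    (if x = a ∧ y = b then rest else γ.chan x y) ++
    (if x = b then (handle H (γ.state b) a m).2 y else [])

/-- One step of an asynchronous execution: the first message of some nonempty queue is handled. -/
def Step (γ γ' : Config V D) : Prop :=
  ∃ a b m rest, γ.chan a b = m :: rest ∧ γ' = deliver H γ a b m rest

end Algorithm

end HSCAI

/-!
The partial costs exchanged by the agents are measured against one function: `subCost i σ`, the cost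
of the complete assignment `σ` on the sub-tree rooted at `i`. Since the ends of a constraint lie on
one branch, `subCost` of an agent is its local cost plus `subCost` of its children (`subCost_eq`),
and `subCost` of the root is the global cost (`subCost_root`).

*Bounds.* Minimizing out dimensions only lowers a utility, and fixing the dimensions of a pattern
does not change it on the assignments that extend the pattern. So all preprocessing and
context-based utilities are lower bounds of `subCost`, on all assignments that extend their pattern
(`UtilOK.preOut`, `UtilOK.ctxtOut`). This is all that is needed of the inference: which patterns are
formed, and when they are exchanged, does not matter.

*Search of one agent.* Under a fixed CPA each value is either dominated, in that no assignment with
it costs less than the current upper bound, or all stored `lb` are lower bounds (`SearchOK`). A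
value that is pruned becomes dominated, and so does one for which a branch returns without a
solution, by the choice of the bound handed down (`SearchOK.dominated_of_childBound`); the upper
bound only decreases. When no branch is being explored, each value is dominated or solved
completely, so the answer of the agent is right (`SearchOK.answer_best`).

*Search of the tree.* On each tree edge, if the parent explores a value in this branch, then exactly
one of the following holds: the CPA is under way, or the child is working on it, or the right answer
is under way (`Link`). This invariant, together with the ones for the preprocessing and for single
agents, is kept by every step (`Searching.deliver`) until the root, for which the CPA is empty and
the upper bound infinite, has found an optimal solution; from then on the solution is passed down
(`Finished.deliver`). A configuration of the first kind has messages in transit: otherwise, going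
up from the leaves, all agents would be ready, hence the root active, and all would be idle
(`Searching.exists_chan_ne_nil`). In a configuration of the second kind without messages all agents
have received the solution.

*Termination.* Messages get natural numbers as weights, defined by recursion on the tree, such that
a message outweighs what its addressee sends in return; the CPAs that an agent can still send under
its present CPA are paid for when that CPA arrives. The total weight decreases with every step
(`Weights.deliver_lt`).
-/

set_option linter.unusedSectionVars false

namespace HSCAI

/-! ### The tree -/

section Tree

variable {V : Type*} {G : SimpleGraph V} (T : PseudoTree G)

theorem PseudoTree.wf_parent : WellFounded fun p c => T.parent c = some p := by
  refine ⟨fun v => ?_⟩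
  induction T.reaches_root v using Relation.ReflTransGen.head_induction_on with
  | refl => exact ⟨_, fun p hp => by simp [T.parent_root] at hp⟩
  | head h _ ih =>
    refine ⟨_, fun p hp => ?_⟩
    rw [h] at hp
    cases hp
    exact ih

theorem PseudoTree.not_transGen_self (v : V) :
    ¬ Relation.TransGen (fun a b => T.parent a = some b) v v := by
  intro h
  have h' : Relation.TransGen (fun p c => T.parent c = some p) v v := Relation.transGen_swap.1 h
  exact T.wf_parent.transGen.asymmetric v v h' h'

theorem PseudoTree.parent_ne {c p : V} (h : T.parent c = some p) : c ≠ p := by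
  rintro rfl
  exact T.not_transGen_self c (.single h)

theorem PseudoTree.exists_parent {i : V} (hi : i ≠ T.root) : ∃ p, T.parent i = some p := by
  rcases (T.reaches_root i).cases_head with h | ⟨p, hp, -⟩
  · exact absurd h hi
  · exact ⟨p, hp⟩

theorem PseudoTree.ne_root {c p : V} (h : T.parent c = some p) : c ≠ T.root := by
  rintro rfl
  simp [T.parent_root] at h

theorem PseudoTree.wf_child [Finite V] : WellFounded fun c p => T.parent c = some p := by
  have : Std.Irrefl (Relation.TransGen fun a b => T.parent a = some b) :=
    ⟨T.not_transGen_self⟩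
  exact Subrelation.wf (fun h => .single h)
    (Finite.wellFounded_of_trans_of_irrefl (Relation.TransGen fun a b => T.parent a = some b))

end Tree

section Subtree

variable {V : Type*} {D : V → Type*} [Fintype V] (H : Setup V D)

@[simp] theorem mem_children {i c : V} : c ∈ H.children i ↔ H.tree.parent c = some i := by
  simp [Setup.children]

@[simp] theorem mem_allParents {i j : V} :
    j ∈ H.allParents i ↔ H.dcop.graph.Adj i j ∧ H.Anc j i := by
  simp [Setup.allParents]

/-- The agents of the sub-tree rooted at `i`. -/
noncomputable def subtree (i : V) : Finset V :=
  Finset.univ.filter fun j => Relation.ReflTransGen (fun a b => H.tree.parent a = some b) j i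

@[simp] theorem mem_subtree {i j : V} : j ∈ subtree H i ↔
    Relation.ReflTransGen (fun a b => H.tree.parent a = some b) j i := by
  simp [subtree]

theorem mem_subtree_iff {i j : V} :
    j ∈ subtree H i ↔ j = i ∨ ∃ c ∈ H.children i, j ∈ subtree H c := by
  rw [mem_subtree, Relation.ReflTransGen.cases_tail_iff]
  simp only [mem_children, mem_subtree, eq_comm (a := i), and_comm]

theorem subtree_eq (i : V) :
    subtree H i = insert i ((H.children i).biUnion (subtree H)) := by
  ext j
  rw [mem_subtree_iff]
  simp

theorem self_notMem_subtree_child {i c : V} (hc : c ∈ H.children i) : i ∉ subtree H c := by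
  intro h
  simp only [mem_children, mem_subtree] at hc h
  exact H.tree.not_transGen_self i (.tail' h hc)

theorem eq_of_mem_subtree_children {i c c' j : V} (hc : c ∈ H.children i)
    (hc' : c' ∈ H.children i) (hj : j ∈ subtree H c) (hj' : j ∈ subtree H c') : c = c' := by
  have key : ∀ {c c'}, c ∈ H.children i → c' ∈ H.children i →
      Relation.ReflTransGen (fun a b => H.tree.parent a = some b) c c' → c = c' := by
    intro c c' hc hc' h
    rcases h.cases_head with h | ⟨p, hp, h⟩
    · exact h
    · rw [mem_children] at hc hc'
      rw [hc] at hp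
      cases hp
      exact absurd (.tail' h hc') (H.tree.not_transGen_self i)
  rw [mem_subtree] at hj hj'
  have hU : Relator.RightUnique fun a b => H.tree.parent a = some b := by
    intro a b b' h h'
    rw [h] at h'
    exact Option.some.inj h'
  rcases Relation.ReflTransGen.total_of_right_unique hU hj hj' with h | h
  · exact key hc hc' h
  · exact (key hc' hc h).symm

theorem subtree_root : subtree H H.tree.root = Finset.univ := by
  ext j
  simp [H.tree.reaches_root j]

/-! ### Costs of sub-trees -/

/-- The cost of the complete assignment `σ` on the sub-tree rooted at `i`: every agent of the
sub-tree accounts for its constraints with its own ancestors. -/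
noncomputable def subCost (i : V) (σ : ∀ j, D j) : ℝ≥0∞ :=
  ∑ j ∈ subtree H i, (localUtil H j).val σ

theorem subCost_eq (i : V) (σ : ∀ j, D j) :
    subCost H i σ = (localUtil H i).val σ + ∑ c ∈ H.children i, subCost H c σ := by
  unfold subCost
  rw [subtree_eq, Finset.sum_insert, Finset.sum_biUnion]
  · intro c hc c' hc' hne
    refine Finset.disjoint_left.2 fun j hj hj' => hne ?_
    exact eq_of_mem_subtree_children H hc hc' hj hj'
  · simp only [Finset.mem_biUnion, not_exists, not_and]
    exact fun c hc => self_notMem_subtree_child H hc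

theorem subCost_ne_top (i : V) (σ : ∀ j, D j) : subCost H i σ ≠ ⊤ := by
  simp [subCost, localUtil, ENNReal.sum_eq_top]

/-- Since the two ends of a constraint lie on one branch, each constraint is counted exactly once,
at its lower end. -/
theorem subCost_root (σ : ∀ j, D j) : subCost H H.tree.root σ = H.dcop.cost σ := by
  unfold subCost localUtil DCOP.cost
  simp only [subtree_root]
  push_cast
  rw [Finset.sum_sigma']
  refine Finset.sum_bij (fun x _ => s(x.1, x.2)) ?_ ?_ ?_ ?_
  · rintro ⟨i, j⟩ h
    simp only [Finset.mem_sigma, Finset.mem_univ, mem_allParents, true_and] at h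
    simpa using h.1
  · rintro ⟨i, j⟩ h ⟨i', j'⟩ h' e
    simp only [Finset.mem_sigma, Finset.mem_univ, mem_allParents, true_and] at h h'
    rcases Sym2.eq_iff.1 e with ⟨rfl, rfl⟩ | ⟨h₁, h₂⟩
    · rfl
    · simp only at h₁ h₂
      subst h₁ h₂
      exact absurd (h.2.trans h'.2) (H.tree.not_transGen_self _)
  · intro e
    induction e with | _ u v
    intro h
    rw [SimpleGraph.mem_edgeFinset, SimpleGraph.mem_edgeSet] at h
    rcases H.tree.same_branch u v h with h' | h'
    · exact ⟨⟨v, u⟩, by simpa using ⟨h.symm, h'⟩, Sym2.eq_swap⟩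
    · exact ⟨⟨u, v⟩, by simpa using ⟨h, h'⟩, rfl⟩
  · rintro ⟨i, j⟩ h
    rfl

/-- If `A` assigns the agent and all its ancestors, then all complete extensions of `A` give the same
local cost, so the infimum in `at'` is the value at each of them. -/
theorem localUtil_at_eq {i : V} {A : Asg V D} {σ : ∀ j, D j} (hσ : A ⊆ asg σ)
    (hi : ∃ d, (⟨i, d⟩ : Σ j, D j) ∈ A) (hA : ∀ j, H.Anc j i → ∃ d, (⟨j, d⟩ : Σ j, D j) ∈ A) :
    (localUtil H i).at' A = (localUtil H i).val σ := by
  have agree : ∀ {τ : ∀ j, D j} {j}, A ⊆ asg τ → (∃ d, (⟨j, d⟩ : Σ j, D j) ∈ A) → τ j = σ j := by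
    rintro τ j hτ ⟨d, hd⟩
    obtain ⟨j', hj'⟩ := hτ hd
    obtain ⟨j'', hj''⟩ := hσ hd
    obtain rfl : j' = j := congrArg Sigma.fst hj'
    obtain rfl : j'' = j' := congrArg Sigma.fst hj''
    exact (eq_of_heq (Sigma.mk.inj hj').2).trans (eq_of_heq (Sigma.mk.inj hj'').2).symm
  refine le_antisymm (iInf₂_le σ hσ) (le_iInf₂ fun τ hτ => le_of_eq ?_)
  refine Finset.sum_congr rfl fun j hj => ?_
  rw [mem_allParents] at hj
  rw [agree hτ hi, agree hτ (hA j hj.2)]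

/-! ### Lower bounds and solutions of a branch -/

/-- `v` is a lower bound for the cost of the sub-tree of `c` under the partial assignment `pa`. -/
def LowerBound (c : V) (pa : Asg V D) (v : ℝ≥0∞) : Prop :=
  ∀ σ, pa ⊆ asg σ → v ≤ subCost H c σ

/-- The utility `w` never exceeds the cost of the sub-tree of `c` under the pattern `p`. -/
def ValidUtil (c : V) (p : Asg V D) (w : Util V D) : Prop :=
  ∀ σ, p ⊆ asg σ → w.val σ ≤ subCost H c σ

/-- `A` assigns exactly one value to each agent of the sub-tree of `c`, and together with `pa` it
has cost `v` there. -/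
structure IsSolution (c : V) (pa : Asg V D) (v : ℝ≥0∞) (A : Asg V D) : Prop where
  cost : ∀ σ, pa ⊆ asg σ → A ⊆ asg σ → subCost H c σ = v
  dims : ∀ j, (∃ d, (⟨j, d⟩ : Σ j, D j) ∈ A) ↔ j ∈ subtree H c
  unique : ∀ j d d', (⟨j, d⟩ : Σ j, D j) ∈ A → (⟨j, d'⟩ : Σ j, D j) ∈ A → d = d'

theorem IsSolution.exists_eq_asg {pa : Asg V D} {v : ℝ≥0∞} {A : Asg V D}
    (h : IsSolution H H.tree.root pa v A) : ∃ σ, A = asg σ := by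
  have : ∀ j, ∃ d, (⟨j, d⟩ : Σ j, D j) ∈ A := fun j => by
    rw [h.dims, subtree_root]
    exact Finset.mem_univ j
  choose σ hσ using this
  refine ⟨σ, Set.Subset.antisymm ?_ ?_⟩
  · rintro ⟨j, d⟩ hd
    exact ⟨j, by rw [h.unique j _ _ hd (hσ j)]⟩
  · rintro _ ⟨j, rfl⟩
    exact hσ j

/-- An agent's value and solutions of its branches make up a solution of its sub-tree. -/
theorem IsSolution.join {i : V} {d : D i} {pa : Asg V D} {v : V → ℝ≥0∞} {A : V → Asg V D}
    (hpa : ∀ j, H.Anc j i → ∃ d, (⟨j, d⟩ : Σ j, D j) ∈ pa)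
    (h : ∀ c ∈ H.children i, IsSolution H c (insert ⟨i, d⟩ pa) (v c) (A c)) :
    IsSolution H i pa ((localUtil H i).at' (insert ⟨i, d⟩ pa) + ∑ c ∈ H.children i, v c)
      (insert ⟨i, d⟩ (⋃ c ∈ H.children i, A c)) where
  cost σ hσ hA := by
    have hins : insert (⟨i, d⟩ : Σ j, D j) pa ⊆ asg σ :=
      Set.insert_subset (hA (Set.mem_insert _ _)) hσ
    rw [subCost_eq, localUtil_at_eq H hins ⟨d, Set.mem_insert _ _⟩
      fun j hj => (hpa j hj).imp fun _ => Set.mem_insert_of_mem _]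
    congr 1
    refine Finset.sum_congr rfl fun c hc => (h c hc).cost σ hins fun x hx => hA ?_
    exact Set.mem_insert_of_mem _ (Set.mem_biUnion hc hx)
  dims j := by
    rw [mem_subtree_iff]
    constructor
    · rintro ⟨e, he⟩
      rcases he with he | he
      · cases he
        exact .inl rfl
      · obtain ⟨c, hc, he⟩ := Set.mem_iUnion₂.1 he
        exact .inr ⟨c, hc, ((h c hc).dims j).1 ⟨e, he⟩⟩
    · rintro (rfl | ⟨c, hc, hj⟩)
      · exact ⟨d, Set.mem_insert _ _⟩
      · obtain ⟨e, he⟩ := ((h c hc).dims j).2 hj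
        exact ⟨e, Set.mem_insert_of_mem _ (Set.mem_biUnion hc he)⟩
  unique j e e' he he' := by
    have hi : ∀ e, (⟨i, e⟩ : Σ j, D j) ∉ ⋃ c ∈ H.children i, A c := by
      intro e he
      obtain ⟨c, hc, he⟩ := Set.mem_iUnion₂.1 he
      exact self_notMem_subtree_child H hc (((h c hc).dims i).1 ⟨e, he⟩)
    rcases he with he | he
    · cases he
      rcases he' with he' | he'
      · cases he'
        rfl
      · exact absurd he' (hi _)
    · rcases he' with he' | he'
      · cases he'
        exact absurd he (hi _)
      · obtain ⟨c, hc, he⟩ := Set.mem_iUnion₂.1 he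
        obtain ⟨c', hc', he'⟩ := Set.mem_iUnion₂.1 he'
        obtain rfl := eq_of_mem_subtree_children H hc hc' (((h c hc).dims j).1 ⟨e, he⟩)
          (((h c' hc').dims j).1 ⟨e', he'⟩)
        exact (h c hc).unique j e e' he he'

end Subtree

section Agent

variable {V : Type*} {D : V → Type*} [Fintype V] [∀ j, Fintype (D j)] [∀ j, LinearOrder (D j)]
variable (H : Setup V D) {i : V}

/-! ### The inferred utilities are lower bounds -/

/-- All utilities that the agent has received from its children are lower bounds. -/
structure UtilOK (s : State V D i) : Prop where
  pre : ∀ c x, s.pre c = some x → ValidUtil H c ∅ x.2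
  ctxtUtil : ∀ c x, s.ctxtUtil c = some x → ValidUtil H c x.1 x.2

variable {H}

theorem UtilOK.childPre {s : State V D i} (hs : UtilOK H s) (c : V) (σ : ∀ j, D j) :
    (childPre s c).val σ ≤ subCost H c σ := by
  unfold HSCAI.childPre
  cases h : s.pre c with
  | none => simp
  | some x => simpa using hs.pre c x h σ (Set.empty_subset _)

theorem Util.minOut_le (S : Finset V) (w : Util V D) (σ : ∀ j, D j) :
    (w.minOut S).val σ ≤ w.val σ :=
  iInf₂_le σ fun _ _ => rfl

theorem Util.fix_val {A : Asg V D} (w : Util V D) {σ : ∀ j, D j} (h : A ⊆ asg σ) :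
    (w.fix A).val σ = w.val σ := by
  refine congrArg w.val (funext fun j => ?_)
  split
  · rename_i hj
    obtain ⟨j', hj'⟩ := h hj.choose_spec
    obtain rfl : j' = j := congrArg Sigma.fst hj'
    exact (eq_of_heq (Sigma.mk.inj hj').2).symm
  · rfl

theorem UtilOK.preOut {s : State V D i} (hs : UtilOK H s) : ValidUtil H i ∅ (preOut H s) := by
  intro σ _
  refine (Util.minOut_le _ _ σ).trans ?_
  rw [subCost_eq]
  exact add_le_add le_rfl (Finset.sum_le_sum fun c _ => hs.childPre c σ)

theorem UtilOK.ctxtOut {s : State V D i} (hs : UtilOK H s)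
    (h : ∀ c ∈ inferChild H s, Answered s c) : ValidUtil H i s.ctxt (ctxtOut H s) := by
  intro σ hσ
  refine (Util.minOut_le _ _ σ).trans ?_
  rw [Util.fix_val _ ((Set.sep_subset _ _).trans hσ), subCost_eq]
  refine add_le_add le_rfl (Finset.sum_le_sum fun c _ => ?_)
  dsimp only
  split
  · rename_i hc
    obtain ⟨w, hw⟩ := h c hc
    simpa [hw] using hs.ctxtUtil c _ hw σ ((Set.sep_subset _ _).trans hσ)
  · exact hs.childPre c σ

theorem UtilOK.initLB {s : State V D i} (hs : UtilOK H s) (c : V) (d : D i) :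
    LowerBound H c (insert ⟨i, d⟩ s.cpa) (initLB s c d) := by
  intro σ hσ
  have hp : (HSCAI.childPre s c).at' (insert ⟨i, d⟩ s.cpa) ≤ subCost H c σ :=
    (iInf₂_le σ hσ).trans (hs.childPre c σ)
  unfold HSCAI.initLB
  split
  · rename_i p w hw
    split
    · rename_i hpa
      exact (iInf₂_le σ hσ).trans
        (hs.ctxtUtil c _ hw σ (hpa.trans ((Set.subset_insert _ _).trans hσ)))
    · exact hp
  · exact hp

/-! ### The search of a single agent -/

variable (H)

/-- Under the CPA, no assignment with `x_i = d` costs less than the current upper bound. -/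
def Dominated (s : State V D i) (d : D i) : Prop :=
  LowerBound H i (insert ⟨i, d⟩ s.cpa) (upper H s)

/-- The answer `r` of the sub-tree of `c` to the partial assignment `pa` with upper bound `ub` is
right. -/
def Answer (c : V) (pa : Asg V D) (ub : ℝ≥0∞) : Option (ℝ≥0∞ × Asg V D) → Prop
  | none => LowerBound H c pa ub
  | some (v, A) => IsSolution H c pa v A ∧ LowerBound H c pa v

/-- What the search of an agent maintains under one CPA. The branches in `cs` have just returned
(or have not begun), and are about to explore their next value; their entry in `cur` is outdated. -/
structure SearchOK (s : State V D i) (cs : Finset V) : Prop where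
  anc : ∀ j, H.Anc j i → ∃ d, (⟨j, d⟩ : Σ j, D j) ∈ s.cpa
  sol : ∀ c ∈ H.children i, ∀ d A, s.sol c d = some A →
    IsSolution H c (insert ⟨i, d⟩ s.cpa) (s.lb c d) A
  lb : ∀ d, Dominated H s d ∨
    ∀ c ∈ H.children i, LowerBound H c (insert ⟨i, d⟩ s.cpa) (s.lb c d)
  cur : ∀ c ∈ H.children i, c ∉ cs → ∀ d, s.cur c = some d → d ∈ s.tried c ∧ s.sol c d = none
  untried : ∀ c ∈ H.children i, ∀ d, d ∉ s.tried c → s.sol c d = none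
  returned : ∀ c ∈ H.children i, ∀ d ∈ s.tried c, c ∈ cs ∨ s.cur c ≠ some d →
    s.sol c d ≠ none ∨ Dominated H s d
  finished : ∀ c ∈ H.children i, c ∉ cs → s.cur c = none → ∀ d, d ∉ s.tried c → Dominated H s d

variable {H}

theorem localUtil_at_le (i : V) {A : Asg V D} {σ : ∀ j, D j} (h : A ⊆ asg σ) :
    (localUtil H i).at' A ≤ (localUtil H i).val σ :=
  iInf₂_le σ h

/-- `bound` is a lower bound for any value that is not already dominated. -/
theorem SearchOK.lowerBound_bound {s : State V D i} {cs : Finset V} (hs : SearchOK H s cs)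
    (d : D i) :
    Dominated H s d ∨ LowerBound H i (insert ⟨i, d⟩ s.cpa) (bound H s d) := by
  refine (hs.lb d).imp_right fun h σ hσ => ?_
  rw [subCost_eq]
  exact add_le_add (localUtil_at_le i hσ) (Finset.sum_le_sum fun c hc => h c hc σ hσ)

theorem nextVal_eq_some {s : State V D i} {c : V} {d : D i} (h : nextVal H s c = some d) :
    d ∉ s.tried c ∧ bound H s d < upper H s := by
  unfold nextVal at h
  dsimp only at h
  split at h
  · rename_i hM
    obtain rfl := Option.some.inj h
    simpa using Finset.min'_mem _ hM
  · cases h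

theorem nextVal_eq_none {s : State V D i} {c : V} (h : nextVal H s c = none) {d : D i}
    (hd : d ∉ s.tried c) : upper H s ≤ bound H s d := by
  unfold nextVal at h
  dsimp only at h
  split at h
  · cases h
  · rename_i hM
    by_contra hlt
    exact hM ⟨d, by simpa using ⟨hd, not_le.1 hlt⟩⟩

/-- The bound handed down is chosen such that a branch without a solution below it rules the value
out. -/
theorem SearchOK.dominated_of_childBound {s : State V D i} {cs : Finset V} (hs : SearchOK H s cs)
    {c : V} (hc : c ∈ H.children i) {d : D i}
    (h : LowerBound H c (insert ⟨i, d⟩ s.cpa) (childBound H s c d)) : Dominated H s d := by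
  rcases hs.lb d with hd | hlb
  · exact hd
  intro σ hσ
  have hσc := h σ hσ
  unfold childBound at hσc
  split at hσc
  · rw [tsub_le_iff_right] at hσc
    refine hσc.trans ?_
    rw [subCost_eq H i, ← Finset.add_sum_erase _ _ hc, add_left_comm]
    gcongr with c' hc'
    · exact localUtil_at_le i hσ
    · exact hlb c' (Finset.mem_of_mem_erase hc') σ hσ
  · exact absurd (top_le_iff.1 hσc) (subCost_ne_top H c σ)

theorem SearchOK.advance {s : State V D i} {cs : Finset V} (hs : SearchOK H s cs) :
    SearchOK H (advance H s cs).1 ∅ where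
  anc := hs.anc
  sol := hs.sol
  lb := hs.lb
  cur c hc _ d hd := by
    simp only [HSCAI.advance] at hd ⊢
    split at hd
    · rename_i hcs
      simp only [hcs, if_true, hd, Option.toFinset_some, Finset.mem_union, Finset.mem_singleton,
        or_true, true_and]
      exact hs.untried c hc d (nextVal_eq_some hd).1
    · rename_i hcs
      simpa only [hcs, if_false] using hs.cur c hc hcs d hd
  untried c hc d hd := by
    refine hs.untried c hc d fun h => hd ?_
    simp only [HSCAI.advance]
    split
    · exact Finset.mem_union_left _ h
    · exact h
  returned c hc d hd hcur := by
    simp only [HSCAI.advance, Finset.notMem_empty, false_or] at hd hcur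
    by_cases hcs : c ∈ cs
    · simp only [hcs, if_true, Finset.mem_union, Option.mem_toFinset, Option.mem_def] at hd hcur
      exact hs.returned c hc d (hd.resolve_right hcur) (.inl hcs)
    · simp only [hcs, if_false] at hd hcur
      exact hs.returned c hc d hd (.inr hcur)
  finished c hc _ hcur d hd := by
    simp only [HSCAI.advance] at hd hcur
    by_cases hcs : c ∈ cs
    · simp only [hcs, if_true, Finset.mem_union, not_or] at hd hcur
      rcases hs.lowerBound_bound d with h | h
      · exact h
      · exact fun σ hσ => (nextVal_eq_none hcur hd.1).trans (h σ hσ)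
    · simp only [hcs, if_false] at hd hcur
      exact hs.finished c hc hcs hcur d hd

/-- When no branch is being explored, each value is either dominated or completely solved, so the
answer of the agent is right. -/
theorem SearchOK.answer_best {s : State V D i} (hs : SearchOK H s ∅)
    (hcur : ∀ c ∈ H.children i, s.cur c = none) : Answer H i s.cpa s.ub (best H s) := by
  have hdc : ∀ d, Dominated H s d ∨ Complete H s d := by
    intro d
    by_contra! hd
    obtain ⟨hd, hnc⟩ := hd
    unfold Complete at hnc
    push Not at hnc
    obtain ⟨c, hc, hsol⟩ := hnc
    by_cases ht : d ∈ s.tried c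
    · exact (hs.returned c hc d ht (.inr (by simp [hcur c hc]))).elim (fun h => h hsol) hd
    · exact hd (hs.finished c hc (Finset.notMem_empty _) (hcur c hc) d ht)
  have hupper : LowerBound H i s.cpa (upper H s) := by
    intro σ hσ
    have hins : insert (⟨i, σ i⟩ : Σ j, D j) s.cpa ⊆ asg σ := Set.insert_subset ⟨i, rfl⟩ hσ
    rcases hs.lowerBound_bound (σ i) with h | h
    · exact h σ hins
    rcases hdc (σ i) with h' | h'
    · exact h' σ hins
    · exact inf_le_right.trans ((iInf₂_le _ h').trans (h σ hins))
  unfold best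
  dsimp only
  split
  · rename_i hM
    have hd := Finset.min'_mem _ hM
    set d := Finset.min' _ hM
    simp only [Finset.mem_filter, Finset.mem_univ, true_and] at hd
    refine ⟨?_, hupper⟩
    rw [← hd.2.2]
    refine IsSolution.join H hs.anc fun c hc => hs.sol c hc d _ ?_
    obtain ⟨A, hA⟩ := Option.ne_none_iff_exists'.1 (hd.1 c hc)
    simp [hA]
  · rename_i hM
    -- A complete value of least cost would be a member of the empty set of candidates.
    have : s.ub ≤ upper H s := by
      refine le_inf le_rfl ?_
      by_contra hlt
      rw [not_le, iInf_lt_iff] at hlt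
      obtain ⟨d₀, hd₀⟩ := hlt
      have hc₀ : d₀ ∈ Finset.univ.filter (Complete H s) := by
        by_contra hn
        simp only [Finset.mem_filter, Finset.mem_univ, true_and] at hn
        simp [hn] at hd₀
      obtain ⟨d, hd, hmin⟩ := Finset.exists_min_image _ (bound H s) ⟨d₀, hc₀⟩
      simp only [Finset.mem_filter, Finset.mem_univ, true_and] at hd hmin hc₀
      simp only [hc₀, iInf_pos] at hd₀
      have hlt := (hmin d₀ hc₀).trans_lt hd₀
      refine hM ⟨d, ?_⟩
      simp only [Finset.mem_filter, Finset.mem_univ, true_and]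
      refine ⟨hd, hlt, le_antisymm (le_inf hlt.le (le_iInf₂ hmin)) ?_⟩
      exact inf_le_right.trans (iInf₂_le d hd)
    exact fun σ hσ => this.trans (hupper σ hσ)

/-- The memory from which the search under a new CPA begins. -/
noncomputable def resetSearch (s : State V D i) : State V D i :=
  { s with lb := initLB s, sol := fun _ _ => none, tried := fun _ => ∅, cur := fun _ => none }

theorem UtilOK.searchOK_reset {s : State V D i} (hs : UtilOK H s)
    (hanc : ∀ j, H.Anc j i → ∃ d, (⟨j, d⟩ : Σ j, D j) ∈ s.cpa) :
    SearchOK H (resetSearch s) (H.children i) where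
  anc := hanc
  sol _ _ _ _ h := by cases h
  lb d := .inr fun c _ => hs.initLB c d
  cur c hc h := absurd hc h
  untried _ _ _ _ := rfl
  returned _ _ _ h := absurd h (Finset.notMem_empty _)
  finished c hc h := absurd hc h

/-- The memory after branch `c` has returned `r` for the value `d`. -/
noncomputable def recordAnswer (s : State V D i) (c : V) (d : D i)
    (r : Option (ℝ≥0∞ × Asg V D)) : State V D i :=
  { s with
    lb := fun c' d' => if c' = c ∧ d' = d then (r.map Prod.fst).getD ⊤ else s.lb c' d'
    sol := fun c' d' => if c' = c ∧ d' = d then r.map Prod.snd else s.sol c' d' }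

theorem upper_recordAnswer_le {s : State V D i} {c : V} (hc : c ∈ H.children i) {d : D i}
    (hd : s.sol c d = none) (r : Option (ℝ≥0∞ × Asg V D)) :
    upper H (recordAnswer s c d r) ≤ upper H s := by
  refine le_inf inf_le_left (le_iInf₂ fun e he => ?_)
  have hne : e ≠ d := by
    rintro rfl
    exact he c hc hd
  have hce : Complete H (recordAnswer s c d r) e := by
    intro c' hc'
    simpa [recordAnswer, hne] using he c' hc'
  refine inf_le_right.trans ((iInf₂_le e hce).trans (le_of_eq ?_))
  simp [bound, recordAnswer, hne]

/-- Recording a right answer keeps the search right. -/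
theorem SearchOK.recordAnswer {s : State V D i} (hs : SearchOK H s ∅) {c : V}
    (hc : c ∈ H.children i) {d : D i} (hd : s.cur c = some d) {ub : ℝ≥0∞}
    (hub : LowerBound H c (insert ⟨i, d⟩ s.cpa) ub → Dominated H s d)
    {r : Option (ℝ≥0∞ × Asg V D)} (hr : Answer H c (insert ⟨i, d⟩ s.cpa) ub r) :
    SearchOK H (recordAnswer s c d r) {c} := by
  obtain ⟨htried, hsol⟩ := hs.cur c hc (Finset.notMem_empty _) d hd
  have hup := upper_recordAnswer_le hc hsol r
  have hdom : ∀ {e}, Dominated H s e → Dominated H (HSCAI.recordAnswer s c d r) e :=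
    fun h σ hσ => hup.trans (h σ hσ)
  constructor
  case anc => exact hs.anc
  case sol =>
    intro c' hc' e A hA
    simp only [HSCAI.recordAnswer] at hA ⊢
    split at hA
    · rename_i hce
      obtain ⟨rfl, rfl⟩ := hce
      rcases r with _ | ⟨v, A'⟩
      · cases hA
      · obtain rfl := Option.some.inj hA
        simpa using hr.1
    · rename_i hce
      rw [if_neg hce]
      exact hs.sol c' hc' e A hA
  case lb =>
    intro e
    rcases hs.lb e with h | h
    · exact .inl (hdom h)
    by_cases hed : e = d
    · subst hed
      rcases r with _ | ⟨v, A'⟩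
      · exact .inl (hdom (hub hr))
      · refine .inr fun c' hc' => ?_
        simp only [HSCAI.recordAnswer]
        split
        · rename_i hce
          obtain ⟨rfl, -⟩ := hce
          exact hr.2
        · exact h c' hc'
    · right
      simpa [HSCAI.recordAnswer, hed] using h
  case cur =>
    intro c' hc' hne e he
    rw [Finset.mem_singleton] at hne
    simpa [HSCAI.recordAnswer, hne] using hs.cur c' hc' (Finset.notMem_empty _) e he
  case untried =>
    intro c' hc' e he
    have : ¬ (c' = c ∧ e = d) := by
      rintro ⟨rfl, rfl⟩
      exact he htried
    simpa [HSCAI.recordAnswer, this] using hs.untried c' hc' e he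
  case returned =>
    intro c' hc' e he hcur
    by_cases hce : c' = c ∧ e = d
    · obtain ⟨rfl, rfl⟩ := hce
      rcases r with _ | ⟨v, A'⟩
      · exact .inr (hdom (hub hr))
      · left
        simp [HSCAI.recordAnswer]
    · simp only [HSCAI.recordAnswer, if_neg hce]
      refine (hs.returned c' hc' e he (.inr ?_)).imp_right hdom
      rintro h
      rcases hcur with h' | h'
      · rw [Finset.mem_singleton] at h'
        subst h'
        rw [hd] at h
        exact hce ⟨rfl, (Option.some.inj h).symm⟩
      · exact h' h
  case finished =>
    intro c' hc' hne hcur e he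
    exact hdom (hs.finished c' hc' (Finset.notMem_empty _) hcur e he)

theorem startSearch_eq (s : State V D i) :
    startSearch H s = explore H (resetSearch s) (H.children i) := rfl

theorem onBacktrack_eq {s : State V D i} {c : V} {d : D i} (h : s.cur c = some d)
    (r : Option (ℝ≥0∞ × Asg V D)) :
    onBacktrack H s c r = explore H (recordAnswer s c d r) {c} := by
  simp only [onBacktrack, h]
  rfl

end Agent

section Invariant

variable {V : Type*} {D : V → Type*}

/-! ### Messages in transit -/

/-- The content of a CPA message. -/
def Msg.getCpa : Msg V D → Option (Asg V D × ℝ≥0∞)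
  | .cpa pa ub _ => some (pa, ub)
  | _ => none

/-- The content of a backtrack message. -/
def Msg.getAnswer : Msg V D → Option (Option (ℝ≥0∞ × Asg V D))
  | .backtrack r => some r
  | _ => none

/-- The content of a preprocessing message. -/
def Msg.getPre : Msg V D → Option (Finset V × Util V D)
  | .preUtil sl w => some (sl, w)
  | _ => none

/-- The CPAs in a queue. -/
abbrev cpas (l : List (Msg V D)) : List (Asg V D × ℝ≥0∞) := l.filterMap Msg.getCpa

/-- The answers to CPAs in a queue. -/
abbrev answers (l : List (Msg V D)) : List (Option (ℝ≥0∞ × Asg V D)) := l.filterMap Msg.getAnswer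

/-- The preprocessing messages in a queue. -/
abbrev preUtils (l : List (Msg V D)) : List (Finset V × Util V D) := l.filterMap Msg.getPre

theorem cpas_append (l l' : List (Msg V D)) : cpas (l ++ l') = cpas l ++ cpas l' :=
  List.filterMap_append

theorem answers_append (l l' : List (Msg V D)) : answers (l ++ l') = answers l ++ answers l' :=
  List.filterMap_append

theorem preUtils_append (l l' : List (Msg V D)) :
    preUtils (l ++ l') = preUtils l ++ preUtils l' :=
  List.filterMap_append

/-- The queue from `x` to `b` after `b` has taken a message from its queue with `a`, of which `rest`
remains. -/
noncomputable def received (γ : Config V D) (a b : V) (rest : List (Msg V D)) (x : V) :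
    List (Msg V D) :=
  if x = a then rest else γ.chan x b

theorem mem_received_of_ne {γ : Config V D} {a b : V} {m : Msg V D} {rest : List (Msg V D)}
    (h : γ.chan a b = m :: rest) {x : V} {m' : Msg V D} (hm : m' ∈ γ.chan x b) (hne : m' ≠ m) :
    m' ∈ received γ a b rest x := by
  unfold received
  split
  · rename_i hx
    rw [hx, h] at hm
    exact (List.mem_cons.1 hm).resolve_left hne
  · exact hm

theorem filterMap_received {α : Type*} {f : Msg V D → Option α} {γ : Config V D} {a b : V}
    {m : Msg V D} {rest : List (Msg V D)} (h : γ.chan a b = m :: rest) (hf : f m = none) (x : V) :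
    (received γ a b rest x).filterMap f = (γ.chan x b).filterMap f := by
  unfold received
  split
  · rename_i hx
    rw [hx, h, List.filterMap_cons_none hf]
  · rfl

theorem filterMap_eq_cons_received {α : Type*} {f : Msg V D → Option α} {γ : Config V D} {a b : V}
    {m : Msg V D} {rest : List (Msg V D)} (h : γ.chan a b = m :: rest) {x : α} (hf : f m = some x) :
    (γ.chan a b).filterMap f = x :: (received γ a b rest a).filterMap f := by
  rw [received, if_pos rfl, h, List.filterMap_cons_some hf]

theorem received_of_ne {γ : Config V D} {a b : V} {rest : List (Msg V D)} {x : V} (h : x ≠ a) :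
    received γ a b rest x = γ.chan x b := if_neg h

variable [Fintype V] [∀ j, Fintype (D j)] [∀ j, LinearOrder (D j)]
variable (H : Setup V D)

section Deliver

variable {H} {γ : Config V D} {a i : V} {m : Msg V D} {rest : List (Msg V D)}

theorem deliver_state_self :
    (deliver H γ a i m rest).state i = (handle H (γ.state i) a m).1 :=
  Function.update_self i _ γ.state

theorem deliver_state_of_ne {x : V} (hx : x ≠ i) :
    (deliver H γ a i m rest).state x = γ.state x :=
  Function.update_of_ne hx _ γ.state

theorem deliver_chan_in {x : V} (hx : x ≠ i) :
    (deliver H γ a i m rest).chan x i = received γ a i rest x := by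
  simp only [deliver, received, and_true, hx, if_false, List.append_nil]

theorem deliver_chan_out {y : V} (hy : y ≠ i) :
    (deliver H γ a i m rest).chan i y = γ.chan i y ++ (handle H (γ.state i) a m).2 y := by
  simp only [deliver, hy, and_false, if_false, if_true]

theorem deliver_chan_of_ne {x y : V} (hx : x ≠ i) (hy : y ≠ i) :
    (deliver H γ a i m rest).chan x y = γ.chan x y := by
  simp only [deliver, hx, hy, and_false, if_false, List.append_nil]

theorem mem_deliver_chan (h : γ.chan a i = m :: rest) {x y : V} {m' : Msg V D}
    (hm : m' ∈ (deliver H γ a i m rest).chan x y) :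
    m' ∈ γ.chan x y ∨ x = i ∧ m' ∈ (handle H (γ.state i) a m).2 y := by
  simp only [deliver, List.mem_append] at hm
  rcases hm with hm | hm
  · left
    split at hm
    · rename_i hxy
      rw [hxy.1, hxy.2, h]
      exact List.mem_cons_of_mem _ hm
    · exact hm
  · split at hm
    · exact .inr ⟨‹_›, hm⟩
    · cases hm

end Deliver

/-! ### What the agents send -/

section Sending

variable {H} {i : V}

theorem mem_sendParent {m m' : Msg V D} {y : V} :
    m' ∈ sendParent H i m y ↔ H.tree.parent i = some y ∧ m' = m := by
  unfold sendParent
  cases h : H.tree.parent i with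
  | none => simp [silent]
  | some p =>
    simp only [sendTo, Option.some.injEq, eq_comm (a := p)]
    split <;> simp [*]

theorem sendParent_parent {m : Msg V D} {p : V} (h : H.tree.parent i = some p) :
    sendParent H i m p = [m] := by
  simp [sendParent, h, sendTo]

theorem mem_allocate {s : State V D i} {m : Msg V D} {y : V} (h : m ∈ allocate H s y) :
    ∃ p, m = .ctxt p := by
  unfold allocate at h
  split at h
  · exact ⟨_, List.mem_singleton.1 h⟩
  · cases h

theorem mem_advance {s : State V D i} {cs : Finset V} {m : Msg V D} {y : V}
    (h : m ∈ (advance H s cs).2 y) : y ∈ cs ∧ ∃ pa ub ev, m = .cpa pa ub ev := by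
  simp only [advance] at h
  split at h
  · rename_i hy
    split at h
    · exact ⟨hy, _, _, _, List.mem_singleton.1 h⟩
    · cases h
  · cases h

theorem filterMap_eq_nil_of {α : Type*} {f : Msg V D → Option α} {l : List (Msg V D)}
    (h : ∀ m ∈ l, f m = none) : l.filterMap f = [] := List.filterMap_eq_nil_iff.2 h

/-- No branch is being explored. -/
def Idle (H : Setup V D) (s : State V D i) : Prop := ∀ c ∈ H.children i, s.cur c = none

/-- All preprocessing utilities are there. -/
def Ready (H : Setup V D) (s : State V D i) : Prop := ∀ c ∈ H.children i, s.pre c ≠ none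

theorem conclude_of_ne {s : State V D i} (h : i = H.tree.root → ¬ Idle H s) :
    conclude H s =
      (s, fun j => if Idle H s then sendParent H i (.backtrack (best H s)) j else []) := by
  unfold conclude
  by_cases hs : Idle H s
  · have hi : i ≠ H.tree.root := fun hi => h hi hs
    simp only [hs, if_true]
    exact (if_pos hs).trans (if_neg hi)
  · simp only [hs, if_false]
    exact if_neg hs

theorem explore_of_ne {s : State V D i} {cs : Finset V}
    (h : i = H.tree.root → ¬ Idle H (advance H s cs).1) :
    explore H s cs = ((advance H s cs).1, fun j => (advance H s cs).2 j ++
      if Idle H (advance H s cs).1 then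
        sendParent H i (.backtrack (best H (advance H s cs).1)) j else []) := by
  simp only [explore, conclude_of_ne h]

/-- The messages of an agent that explores: CPAs to the branches, answers to the parent. -/
theorem mem_explore {s : State V D i} {cs : Finset V}
    (h : i = H.tree.root → ¬ Idle H (advance H s cs).1) {m : Msg V D} {y : V}
    (hm : m ∈ (explore H s cs).2 y) :
    (y ∈ cs ∧ ∃ pa ub ev, m = .cpa pa ub ev) ∨
      H.tree.parent i = some y ∧ ∃ r, m = .backtrack r := by
  rw [explore_of_ne h] at hm
  rcases List.mem_append.1 hm with hm | hm
  · exact .inl (mem_advance hm)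
  · split at hm
    · obtain ⟨hp, rfl⟩ := mem_sendParent.1 hm
      exact .inr ⟨hp, _, rfl⟩
    · cases hm

end Sending

/-! ### The invariant of the search -/

/-- What holds of a message in transit from `a` to `b` while the search goes on. -/
def MsgOK (a b : V) : Msg V D → Prop
  | .preUtil _ w => H.tree.parent a = some b ∧ ValidUtil H a ∅ w
  | .cpa _ _ _ => H.tree.parent b = some a
  | .ctxt _ => True
  | .ctxtUtil p w => ValidUtil H a p w
  | .backtrack _ => H.tree.parent a = some b
  | .terminate _ => False

/-- The state of the search on the tree edge from `p` down to `c`, where `l` are the CPAs under way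
to `c`, and `r` the answers under way to `p`. If `p` explores `d` in the branch `c`, then either the
CPA is under way, or `c` is working on it, or the answer is under way, and not two of these.
Otherwise the branch is at rest. -/
def Link {p c : V} (sp : State V D p) (sc : State V D c) (l : List (Asg V D × ℝ≥0∞))
    (r : List (Option (ℝ≥0∞ × Asg V D))) : Prop :=
  (sp.cur c = none ∧ l = [] ∧ r = [] ∧ Idle H sc) ∨
  ∃ d ub, sp.cur c = some d ∧
    (LowerBound H c (insert ⟨p, d⟩ sp.cpa) ub → Dominated H sp d) ∧
    ((l = [(insert ⟨p, d⟩ sp.cpa, ub)] ∧ r = [] ∧ Idle H sc) ∨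
      (l = [] ∧ r = [] ∧ ¬ Idle H sc ∧ sc.cpa = insert ⟨p, d⟩ sp.cpa ∧ sc.ub = ub) ∨
      (l = [] ∧ Idle H sc ∧ ∃ x, r = [x] ∧ Answer H c (insert ⟨p, d⟩ sp.cpa) ub x))

/-- The state of the preprocessing on the tree edge from `c` up to `p`, where `l` are the
preprocessing messages under way: `c` sends one of them, when it is ready. -/
def PreLink {p c : V} (sp : State V D p) (sc : State V D c) (l : List (Finset V × Util V D)) :
    Prop :=
  (¬ Ready H sc ∧ l = [] ∧ sp.pre c = none) ∨
  (Ready H sc ∧ (∃ x, l = [x]) ∧ sp.pre c = none) ∨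
  (Ready H sc ∧ l = [] ∧ sp.pre c ≠ none)

/-- What holds of the root until it has found the solution: it is searching, under the empty CPA,
as soon as it is ready. -/
structure RootOK {i : V} (s : State V D i) : Prop where
  idle_iff : Idle H s ↔ ¬ Ready H s
  cpa : ¬ Idle H s → s.cpa = ∅
  ub : ¬ Idle H s → s.ub = ⊤

/-- The invariant of the configurations in which the root has not found a solution. -/
structure Searching (γ : Config V D) : Prop where
  result : ∀ i, (γ.state i).result = none
  util : ∀ i, UtilOK H (γ.state i)
  msg : ∀ a b, ∀ m ∈ γ.chan a b, MsgOK H a b m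
  pre : ∀ c p, H.tree.parent c = some p →
    PreLink H (γ.state p) (γ.state c) (preUtils (γ.chan c p))
  link : ∀ c p, H.tree.parent c = some p →
    Link H (γ.state p) (γ.state c) (cpas (γ.chan p c)) (answers (γ.chan c p))
  search : ∀ i, ¬ Idle H (γ.state i) → SearchOK H (γ.state i) ∅
  root : RootOK H (γ.state H.tree.root)

/-- The invariant of the configurations in which the root has found the solution `σ`, and passes it
down the tree. -/
structure Finished (σ : ∀ j, D j) (γ : Config V D) : Prop where
  root : (γ.state H.tree.root).result = some (asg σ)
  result : ∀ i, (γ.state i).result = none ∨ (γ.state i).result = some (asg σ)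
  msg : ∀ a b A, Msg.terminate A ∈ γ.chan a b → A = asg σ
  link : ∀ c p, H.tree.parent c = some p → (γ.state p).result ≠ none →
    (γ.state c).result ≠ none ∨ Msg.terminate (asg σ) ∈ γ.chan p c

variable {H}

theorem Link.mono {p c : V} {sp sp' : State V D p} {sc sc' : State V D c}
    {l : List (Asg V D × ℝ≥0∞)} {r : List (Option (ℝ≥0∞ × Asg V D))} (h : Link H sp sc l r)
    (hcur : sp'.cur c = sp.cur c) (hcpa : sp'.cpa = sp.cpa)
    (hdom : ∀ d, Dominated H sp d → Dominated H sp' d)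
    (hcur' : sc'.cur = sc.cur) (hcpa' : sc'.cpa = sc.cpa) (hub' : sc'.ub = sc.ub) :
    Link H sp' sc' l r := by
  unfold Link Idle at *
  rw [hcur, hcpa, hcur', hcpa', hub']
  refine h.imp_right ?_
  rintro ⟨d, ub, h₁, h₂, h₃⟩
  exact ⟨d, ub, h₁, fun h => hdom d (h₂ h), h₃⟩

theorem not_idle_of_cur {γ : Config V D} {c p : V} (hc : c ∈ H.children p)
    {d : D p} (hd : (γ.state p).cur c = some d) : ¬ Idle H (γ.state p) := by
  intro h
  simp [h c hc] at hd

/-- To show that a step keeps the invariant, only the agent that reacts and the tree edges at it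
have to be considered. -/
theorem Searching.deliver_of {γ : Config V D} (hγ : Searching H γ) {a i : V} {m : Msg V D}
    {rest : List (Msg V D)} (hm : γ.chan a i = m :: rest) {s : State V D i} {out : Out V D}
    (hh : handle H (γ.state i) a m = (s, out))
    (hresult : s.result = none) (hutil : UtilOK H s)
    (hmsg : ∀ y, ∀ m ∈ out y, MsgOK H i y m)
    (hpre_up : ∀ p, H.tree.parent i = some p →
      PreLink H (γ.state p) s (preUtils (γ.chan i p ++ out p)))
    (hpre_down : ∀ c ∈ H.children i,
      PreLink H s (γ.state c) (preUtils (received γ a i rest c)))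
    (hlink_up : ∀ p, H.tree.parent i = some p →
      Link H (γ.state p) s (cpas (received γ a i rest p)) (answers (γ.chan i p ++ out p)))
    (hlink_down : ∀ c ∈ H.children i,
      Link H s (γ.state c) (cpas (γ.chan i c ++ out c)) (answers (received γ a i rest c)))
    (hsearch : ¬ Idle H s → SearchOK H s ∅)
    (hroot : i = H.tree.root → RootOK H s) :
    Searching H (deliver H γ a i m rest) := by
  have hs : (deliver H γ a i m rest).state i = s := by rw [deliver_state_self, hh]
  have hout : ∀ {y}, y ≠ i → (deliver H γ a i m rest).chan i y = γ.chan i y ++ out y := by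
    intro y hy
    rw [deliver_chan_out hy, hh]
  constructor
  case result =>
    intro j
    by_cases hj : j = i
    · subst hj
      rw [hs, hresult]
    · rw [deliver_state_of_ne hj, hγ.result]
  case util =>
    intro j
    by_cases hj : j = i
    · subst hj
      rwa [hs]
    · rw [deliver_state_of_ne hj]
      exact hγ.util j
  case msg =>
    intro x y m' hm'
    rcases mem_deliver_chan hm hm' with h | ⟨rfl, h⟩
    · exact hγ.msg x y m' h
    · rw [hh] at h
      exact hmsg y m' h
  case pre =>
    intro c p hcp
    have hne := H.tree.parent_ne hcp
    by_cases hc : c = i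
    · subst hc
      rw [hs, hout hne.symm, deliver_state_of_ne hne.symm]
      exact hpre_up p hcp
    by_cases hp : p = i
    · subst hp
      rw [hs, deliver_chan_in hne, deliver_state_of_ne hne]
      exact hpre_down c (by simpa using hcp)
    · rw [deliver_state_of_ne hc, deliver_state_of_ne hp, deliver_chan_of_ne hc hp]
      exact hγ.pre c p hcp
  case link =>
    intro c p hcp
    have hne := H.tree.parent_ne hcp
    by_cases hc : c = i
    · subst hc
      rw [hs, hout hne.symm, deliver_state_of_ne hne.symm, deliver_chan_in hne.symm]
      exact hlink_up p hcp
    by_cases hp : p = i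
    · subst hp
      rw [hs, deliver_chan_in hne, deliver_state_of_ne hne, hout hne]
      exact hlink_down c (by simpa using hcp)
    · rw [deliver_state_of_ne hc, deliver_state_of_ne hp, deliver_chan_of_ne hc hp,
        deliver_chan_of_ne hp hc]
      exact hγ.link c p hcp
  case search =>
    intro j
    by_cases hj : j = i
    · subst hj
      rwa [hs]
    · rw [deliver_state_of_ne hj]
      exact hγ.search j
  case root =>
    by_cases hj : H.tree.root = i
    · subst hj
      rw [hs]
      exact hroot rfl
    · rw [deliver_state_of_ne hj]
      exact hγ.root

/-- A root without a branch left to explore has found an optimal solution. -/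
theorem SearchOK.exists_optimal [∀ j, Nonempty (D j)] {s : State V D H.tree.root}
    (hs : SearchOK H s ∅) (hidle : Idle H s) (hcpa : s.cpa = ∅) (hub : s.ub = ⊤) :
    ∃ σ v, H.dcop.IsOptimal σ ∧ best H s = some (v, asg σ) := by
  have h := hs.answer_best hidle
  rw [hcpa, hub] at h
  rcases hb : best H s with _ | ⟨v, A⟩
  · rw [hb] at h
    obtain ⟨σ⟩ : Nonempty (∀ j, D j) := inferInstance
    exact absurd (top_le_iff.1 (h σ (Set.empty_subset _))) (subCost_ne_top H _ σ)
  · rw [hb] at h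
    obtain ⟨σ, rfl⟩ := h.1.exists_eq_asg
    refine ⟨σ, v, fun τ => ?_, rfl⟩
    have := h.2 τ (Set.empty_subset _)
    rwa [← h.1.cost σ (Set.empty_subset _) subset_rfl, subCost_root, subCost_root,
      ENNReal.coe_le_coe] at this

theorem explore_root {s : State V D H.tree.root} {cs : Finset V}
    (hidle : Idle H (advance H s cs).1) {v : ℝ≥0∞} {A : Asg V D}
    (hb : best H (advance H s cs).1 = some (v, A)) :
    explore H s cs = ({ (advance H s cs).1 with result := some A }, fun j =>
      (advance H s cs).2 j ++ if j ∈ H.children H.tree.root then [.terminate A] else []) := by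
  have : conclude H (advance H s cs).1 = ({ (advance H s cs).1 with result := some A },
      fun j => if j ∈ H.children H.tree.root then [.terminate A] else []) := by
    unfold conclude
    refine (if_pos hidle).trans ((if_pos rfl).trans ?_)
    rw [hb]
  rw [explore, this]

/-- A branch that advances is at rest, or its CPA is under way. -/
theorem SearchOK.link_advance {i : V} {s : State V D i} {cs : Finset V} (hs : SearchOK H s cs)
    {c : V} (hc : c ∈ H.children i) (hcs : c ∈ cs) {sc : State V D c} (hsc : Idle H sc) :
    Link H (HSCAI.advance H s cs).1 sc (cpas ((HSCAI.advance H s cs).2 c)) [] := by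
  cases hn : nextVal H s c with
  | none =>
    left
    simp [HSCAI.advance, hcs, hn, hsc]
  | some d =>
    right
    refine ⟨d, childBound H s c d, by simp [HSCAI.advance, hcs, hn],
      hs.dominated_of_childBound hc, .inl ⟨?_, rfl, hsc⟩⟩
    simp [HSCAI.advance, hcs, hn, Msg.getCpa]

/-- The step of an agent that lets the branches `cs` explore: the memory before is `s`, and `extra`
are messages of other kinds, sent at the same time. -/
theorem Searching.deliver_explore [∀ j, Nonempty (D j)] {γ : Config V D} (hγ : Searching H γ)
    {a i : V} {m : Msg V D} {rest : List (Msg V D)} (hm : γ.chan a i = m :: rest)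
    {s : State V D i} {cs : Finset V} (hcs : cs ⊆ H.children i) {extra : Out V D}
    (hextra : ∀ y, ∀ m ∈ extra y, ∃ p, m = .ctxt p)
    (hh : handle H (γ.state i) a m =
      ((explore H s cs).1, fun j => extra j ++ (explore H s cs).2 j))
    (hs : SearchOK H s cs) (hresult : s.result = none) (hutil : UtilOK H s)
    (hpre_up : ∀ p, H.tree.parent i = some p →
      PreLink H (γ.state p) s (preUtils (γ.chan i p)))
    (hpre_down : ∀ c ∈ H.children i,
      PreLink H s (γ.state c) (preUtils (received γ a i rest c)))
    (hup : ∀ p, H.tree.parent i = some p → ∃ d, (γ.state p).cur i = some d ∧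
      s.cpa = insert ⟨p, d⟩ (γ.state p).cpa ∧
      (LowerBound H i (insert ⟨p, d⟩ (γ.state p).cpa) s.ub → Dominated H (γ.state p) d) ∧
      cpas (received γ a i rest p) = [] ∧ answers (γ.chan i p) = [])
    (hdown : ∀ c ∈ H.children i, c ∈ cs → cpas (γ.chan i c) = [] ∧
      answers (received γ a i rest c) = [] ∧ Idle H (γ.state c))
    (hdown' : ∀ c ∈ H.children i, c ∉ cs →
      Link H s (γ.state c) (cpas (γ.chan i c)) (answers (received γ a i rest c)))
    (hroot : i = H.tree.root → Ready H s ∧ s.cpa = ∅ ∧ s.ub = ⊤) :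
    Searching H (deliver H γ a i m rest) ∨
      ∃ σ, H.dcop.IsOptimal σ ∧ Finished H σ (deliver H γ a i m rest) := by
  have hadv := hs.advance
  by_cases hfin : i = H.tree.root ∧ Idle H (HSCAI.advance H s cs).1
  · obtain ⟨rfl, hidle⟩ := hfin
    obtain ⟨-, hcpa, hub⟩ := hroot rfl
    obtain ⟨σ, v, hσ, hb⟩ := hadv.exists_optimal hidle hcpa hub
    rw [explore_root hidle hb] at hh
    have hterm : ∀ {x y A}, Msg.terminate A ∈ γ.chan x y → False := fun h => hγ.msg _ _ _ h
    refine .inr ⟨σ, hσ, ?_, ?_, ?_, ?_⟩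
    · rw [deliver_state_self, hh]
    · intro j
      by_cases hj : j = H.tree.root
      · subst hj
        rw [deliver_state_self, hh]
        exact .inr rfl
      · rw [deliver_state_of_ne hj]
        exact .inl (hγ.result j)
    · intro x y A hA
      rcases mem_deliver_chan hm hA with h | ⟨-, h⟩
      · exact (hterm h).elim
      · simp only [hh, List.mem_append] at h
        rcases h with h | h | h
        · obtain ⟨p, hp⟩ := hextra y _ h
          cases hp
        · obtain ⟨-, _, _, _, hp⟩ := mem_advance h
          cases hp
        · split at h
          · cases List.mem_singleton.1 h
            rfl
          · cases h
    · intro c p hcp hp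
      right
      have hproot : p = H.tree.root := by
        by_contra hne
        rw [deliver_state_of_ne hne, hγ.result] at hp
        exact hp rfl
      subst hproot
      rw [deliver_chan_out (H.tree.parent_ne hcp), hh]
      simp [hcp]
  left
  have hni : i = H.tree.root → ¬ Idle H (HSCAI.advance H s cs).1 := fun h h' => hfin ⟨h, h'⟩
  have hmem := fun (m : Msg V D) (y : V) => mem_explore hni (m := m) (y := y)
  have hfst : (explore H s cs).1 = (HSCAI.advance H s cs).1 := by rw [explore_of_ne hni]
  have hsnd : ∀ y, (explore H s cs).2 y = (HSCAI.advance H s cs).2 y ++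
      if Idle H (HSCAI.advance H s cs).1 then
        sendParent H i (.backtrack (best H (HSCAI.advance H s cs).1)) y else [] := by
    intro y
    rw [explore_of_ne hni]
  rw [hfst] at hh
  have hpre : ∀ y, preUtils (extra y ++ (explore H s cs).2 y) = [] := by
    intro y
    refine filterMap_eq_nil_of fun m hm => ?_
    rcases List.mem_append.1 hm with h | h
    · obtain ⟨_, rfl⟩ := hextra y m h
      rfl
    · rcases hmem m y h with ⟨-, _, _, _, rfl⟩ | ⟨-, _, rfl⟩ <;> rfl
  have hcpas : ∀ y, cpas (extra y ++ (explore H s cs).2 y) =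
      cpas ((HSCAI.advance H s cs).2 y) := by
    intro y
    have h₁ : cpas (extra y) = [] := filterMap_eq_nil_of fun m hm => by
      obtain ⟨_, rfl⟩ := hextra y m hm
      rfl
    have h₂ : cpas (if Idle H (HSCAI.advance H s cs).1 then
        sendParent H i (.backtrack (best H (HSCAI.advance H s cs).1)) y else []) = [] :=
      filterMap_eq_nil_of fun m hm => by
        split at hm
        · obtain ⟨-, rfl⟩ := mem_sendParent.1 hm
          rfl
        · cases hm
    rw [hsnd, cpas_append, cpas_append, h₁, h₂, List.nil_append, List.append_nil]
  have hanswers : ∀ p, H.tree.parent i = some p → answers (extra p ++ (explore H s cs).2 p) =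
      if Idle H (HSCAI.advance H s cs).1 then [best H (HSCAI.advance H s cs).1] else [] := by
    intro p hp
    have h₁ : answers (extra p) = [] := filterMap_eq_nil_of fun m hm => by
      obtain ⟨_, rfl⟩ := hextra p m hm
      rfl
    have h₂ : answers ((HSCAI.advance H s cs).2 p) = [] := filterMap_eq_nil_of fun m hm => by
      obtain ⟨-, _, _, _, rfl⟩ := mem_advance hm
      rfl
    rw [hsnd, answers_append, answers_append, h₁, h₂, sendParent_parent hp]
    split <;> rfl
  refine hγ.deliver_of hm hh hresult ⟨hutil.pre, hutil.ctxtUtil⟩ ?_ ?_ hpre_down ?_ ?_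
    (fun _ => hadv) ?_
  · intro y m hm
    rcases List.mem_append.1 hm with h | h
    · obtain ⟨_, rfl⟩ := hextra y m h
      trivial
    · rcases hmem m y h with ⟨hy, _, _, _, rfl⟩ | ⟨hy, _, rfl⟩
      · exact (mem_children H).1 (hcs hy)
      · exact hy
  · intro p hp
    rw [preUtils_append, hpre, List.append_nil]
    exact hpre_up p hp
  · intro p hp
    obtain ⟨d, hd, hcpa, hub, hnil, hnil'⟩ := hup p hp
    rw [hnil, answers_append, hanswers p hp, hnil', List.nil_append]
    refine .inr ⟨d, s.ub, hd, hub, .inr ?_⟩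
    by_cases hidle : Idle H (HSCAI.advance H s cs).1
    · refine .inr ⟨rfl, hidle, _, if_pos hidle, ?_⟩
      rw [← hcpa]
      exact hadv.answer_best hidle
    · exact .inl ⟨rfl, if_neg hidle, hidle, hcpa, rfl⟩
  · intro c hc
    rw [cpas_append, hcpas]
    by_cases hccs : c ∈ cs
    · obtain ⟨h₁, h₂, h₃⟩ := hdown c hc hccs
      rw [h₁, h₂, List.nil_append]
      exact hs.link_advance hc hccs h₃
    · have : cpas ((HSCAI.advance H s cs).2 c) = [] :=
        filterMap_eq_nil_of fun m hm => absurd (mem_advance hm).1 hccs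
      rw [this, List.append_nil]
      exact (hdown' c hc hccs).mono (by simp [HSCAI.advance, hccs]) rfl (fun _ h => h) rfl rfl rfl
  · intro hi
    obtain ⟨h₁, h₂, h₃⟩ := hroot hi
    exact ⟨⟨fun h => absurd h (hni hi), fun h => absurd h₁ h⟩, fun _ => h₂, fun _ => h₃⟩

end Invariant

section Steps

variable {V : Type*} {D : V → Type*} [Fintype V] [∀ j, Fintype (D j)] [∀ j, LinearOrder (D j)]
variable {H : Setup V D} {γ : Config V D} {a i : V} {m : Msg V D} {rest : List (Msg V D)}

/-! ### Every step keeps the invariant -/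

theorem handle_eq_self {s : State V D i} (hs : s.result ≠ none) :
    handle H s a m = (s, silent) := if_pos hs

/-- A step that has no part in the search keeps the invariant. -/
theorem Searching.deliver_quiet (hγ : Searching H γ) (hm : γ.chan a i = m :: rest)
    {s : State V D i} {out : Out V D} (hh : handle H (γ.state i) a m = (s, out))
    (hcpa : m.getCpa = none) (hanswer : m.getAnswer = none)
    (hs : s = { γ.state i with
      pre := s.pre, eval := s.eval, ctxt := s.ctxt, starter := s.starter, ctxtUtil := s.ctxtUtil })
    (hutil : UtilOK H s)
    (hmsg : ∀ y, ∀ m ∈ out y, MsgOK H i y m ∧ m.getCpa = none ∧ m.getAnswer = none)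
    (hpre_up : ∀ p, H.tree.parent i = some p →
      PreLink H (γ.state p) s (preUtils (γ.chan i p ++ out p)))
    (hpre_down : ∀ c ∈ H.children i,
      PreLink H s (γ.state c) (preUtils (received γ a i rest c)))
    (hroot : i = H.tree.root → (Ready H s ↔ Ready H (γ.state i))) :
    Searching H (deliver H γ a i m rest) := by
  have hcur : s.cur = (γ.state i).cur := by rw [hs]
  have hcpa' : s.cpa = (γ.state i).cpa := by rw [hs]
  have hub : s.ub = (γ.state i).ub := by rw [hs]
  have hidle : Idle H s ↔ Idle H (γ.state i) := by rw [Idle, Idle, hcur]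
  refine hγ.deliver_of hm hh ?_ hutil (fun y m h => (hmsg y m h).1) hpre_up hpre_down ?_ ?_ ?_ ?_
  · rw [hs]
    exact hγ.result i
  · intro p hp
    have h : answers (out p) = [] := filterMap_eq_nil_of fun m h => (hmsg p m h).2.2
    rw [answers_append, h, List.append_nil, cpas, filterMap_received hm hcpa]
    exact (hγ.link i p hp).mono rfl rfl (fun _ h => h) hcur hcpa' hub
  · intro c hc
    have h : cpas (out c) = [] := filterMap_eq_nil_of fun m h => (hmsg c m h).2.1
    rw [cpas_append, h, List.append_nil, answers, filterMap_received hm hanswer]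
    refine (hγ.link c i ((mem_children H).1 hc)).mono (by rw [hcur]) hcpa' (fun d hd => ?_)
      rfl rfl rfl
    rw [hs]
    exact hd
  · intro hi
    have h := hγ.search i (by rwa [← hidle])
    rw [hs]
    exact ⟨h.anc, h.sol, h.lb, h.cur, h.untried, h.returned, h.finished⟩
  · rintro hi
    have h := hγ.root
    rw [← hi] at h
    refine ⟨?_, ?_, ?_⟩
    · rw [hidle, hroot hi]
      exact h.idle_iff
    · rw [hidle, hcpa']
      exact h.cpa
    · rw [hidle, hub]
      exact h.ub

theorem PreLink.mono {p c : V} {sp sp' : State V D p} {sc sc' : State V D c}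
    {l : List (Finset V × Util V D)} (h : PreLink H sp sc l) (hp : sp'.pre c = sp.pre c)
    (hc : sc'.pre = sc.pre) : PreLink H sp' sc' l := by
  unfold PreLink Ready at *
  rwa [hp, hc]

theorem preprocess_of_ne {s : State V D i} (h : i = H.tree.root → ¬ Ready H s) :
    preprocess H s = (s, fun j => if Ready H s then
      sendParent H i (.preUtil (slist H s) (preOut H s)) j else []) := by
  by_cases hs : Ready H s
  · simp only [hs, if_true]
    exact (if_pos hs).trans (if_neg fun hi => h hi hs)
  · simp only [hs, if_false]
    exact if_neg hs

theorem preprocess_root {s : State V D H.tree.root} (h : Ready H s) :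
    preprocess H s = explore H (resetSearch { s with cpa := ∅, ub := ⊤, eval := true })
      (H.children H.tree.root) :=
  (if_pos h).trans (if_pos rfl)

theorem not_anc_root (j : V) : ¬ H.Anc j H.tree.root := by
  intro h
  obtain ⟨p, hp, -⟩ := Relation.TransGen.head'_iff.1 h
  simp [H.tree.parent_root] at hp

theorem Searching.deliver_ctxt (hγ : Searching H γ) {p : Asg V D}
    (hm : γ.chan a i = .ctxt p :: rest) : Searching H (deliver H γ a i (.ctxt p) rest) := by
  have hh : handle H (γ.state i) a (.ctxt p) = onCtxt H (γ.state i) p :=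
    if_neg (not_not.2 (hγ.result i))
  set s : State V D i := { γ.state i with ctxt := p, starter := false, eval := false }
  have hutil : UtilOK H s := ⟨(hγ.util i).pre, (hγ.util i).ctxtUtil⟩
  have hmem : ∀ y, ∀ m ∈ (onCtxt H (γ.state i) p).2 y,
      MsgOK H i y m ∧ m.getCpa = none ∧ m.getAnswer = none ∧ m.getPre = none := by
    intro y m hm
    simp only [onCtxt] at hm
    split at hm
    · rename_i hempty
      obtain ⟨-, rfl⟩ := mem_sendParent.1 hm
      refine ⟨hutil.ctxtOut fun c hc => ?_, rfl, rfl, rfl⟩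
      rw [hempty] at hc
      exact absurd hc (Finset.notMem_empty c)
    · obtain ⟨_, rfl⟩ := mem_allocate hm
      exact ⟨trivial, rfl, rfl, rfl⟩
  refine hγ.deliver_quiet hm (s := s) (out := (onCtxt H (γ.state i) p).2) hh rfl rfl rfl
    hutil (fun y m h => ⟨(hmem y m h).1, (hmem y m h).2.1, (hmem y m h).2.2.1⟩)
    ?_ ?_ fun _ => Iff.rfl
  · intro p' hp'
    have h : preUtils ((onCtxt H (γ.state i) p).2 p') = [] :=
      filterMap_eq_nil_of fun m h => (hmem p' m h).2.2.2
    rw [preUtils_append, h, List.append_nil]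
    exact (hγ.pre i p' hp').mono rfl rfl
  · intro c hc
    rw [preUtils, filterMap_received hm rfl]
    exact (hγ.pre c i ((mem_children H).1 hc)).mono rfl rfl

theorem Searching.deliver_ctxtUtil (hγ : Searching H γ) {p : Asg V D} {w : Util V D}
    (hm : γ.chan a i = .ctxtUtil p w :: rest) :
    Searching H (deliver H γ a i (.ctxtUtil p w) rest) := by
  have hh : handle H (γ.state i) a (.ctxtUtil p w) = onCtxtUtil H (γ.state i) a p w :=
    if_neg (not_not.2 (hγ.result i))
  have hw : ValidUtil H a p w := hγ.msg a i (.ctxtUtil p w) (by simp [hm])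
  set s : State V D i := { γ.state i with
    ctxtUtil := Function.update (γ.state i).ctxtUtil a (some (p, w)) } with hsdef
  have hutil : UtilOK H s := by
    refine ⟨(hγ.util i).pre, fun c x hx => ?_⟩
    by_cases hc : c = a
    · subst hc
      rw [hsdef] at hx
      simp only [Function.update_self, Option.some.injEq] at hx
      rwa [← hx]
    · rw [hsdef] at hx
      simp only [Function.update_of_ne hc] at hx
      exact (hγ.util i).ctxtUtil c x hx
  have hmem : ∀ y, ∀ m ∈ (onCtxtUtil H (γ.state i) a p w).2 y,
      MsgOK H i y m ∧ m.getCpa = none ∧ m.getAnswer = none ∧ m.getPre = none := by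
    intro y m hm
    simp only [onCtxtUtil] at hm
    split at hm
    · rename_i h
      obtain ⟨-, rfl⟩ := mem_sendParent.1 hm
      exact ⟨hutil.ctxtOut h.2.2, rfl, rfl, rfl⟩
    · cases hm
  refine hγ.deliver_quiet hm (s := s) (out := (onCtxtUtil H (γ.state i) a p w).2) hh rfl rfl rfl
    hutil (fun y m h => ⟨(hmem y m h).1, (hmem y m h).2.1, (hmem y m h).2.2.1⟩)
    ?_ ?_ fun _ => Iff.rfl
  · intro p' hp'
    have h : preUtils ((onCtxtUtil H (γ.state i) a p w).2 p') = [] :=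
      filterMap_eq_nil_of fun m h => (hmem p' m h).2.2.2
    rw [preUtils_append, h, List.append_nil]
    exact (hγ.pre i p' hp').mono rfl rfl
  · intro c hc
    rw [preUtils, filterMap_received hm rfl]
    exact (hγ.pre c i ((mem_children H).1 hc)).mono rfl rfl

/-- The last preprocessing utility makes an agent ready: the root then begins the search, any other
agent reports to its parent. -/
theorem Searching.deliver_preUtil [∀ j, Nonempty (D j)] (hγ : Searching H γ) {sl : Finset V}
    {w : Util V D} (hm : γ.chan a i = .preUtil sl w :: rest) :
    Searching H (deliver H γ a i (.preUtil sl w) rest) ∨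
      ∃ σ, H.dcop.IsOptimal σ ∧ Finished H σ (deliver H γ a i (.preUtil sl w) rest) := by
  obtain ⟨hai, hw⟩ : H.tree.parent a = some i ∧ ValidUtil H a ∅ w :=
    hγ.msg a i (.preUtil sl w) (by simp [hm])
  set s : State V D i := { γ.state i with
    pre := Function.update (γ.state i).pre a (some (sl, w)) } with hsdef
  have hh : handle H (γ.state i) a (.preUtil sl w) = preprocess H s :=
    if_neg (not_not.2 (hγ.result i))
  have hutil : UtilOK H s := by
    refine ⟨fun c x hx => ?_, (hγ.util i).ctxtUtil⟩
    by_cases hc : c = a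
    · subst hc
      rw [hsdef] at hx
      simp only [Function.update_self, Option.some.injEq] at hx
      rwa [← hx]
    · rw [hsdef] at hx
      simp only [Function.update_of_ne hc] at hx
      exact (hγ.util i).pre c x hx
  have hlink := hγ.pre a i hai
  rw [preUtils, filterMap_eq_cons_received (f := Msg.getPre) hm rfl] at hlink
  -- Exactly one preprocessing message is under way on this edge, so the agent was not ready.
  obtain ⟨hready_a, hnil, hnone⟩ : Ready H (γ.state a) ∧
      preUtils (received γ a i rest a) = [] ∧ (γ.state i).pre a = none := by
    rcases hlink with ⟨-, h, -⟩ | ⟨h₁, ⟨x, h₂⟩, h₃⟩ | ⟨-, h, -⟩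
    · cases h
    · exact ⟨h₁, (List.cons.inj h₂).2, h₃⟩
    · cases h
  have hnot : ¬ Ready H (γ.state i) := fun h => h a (by simpa using hai) hnone
  have hdown : ∀ c ∈ H.children i,
      PreLink H s (γ.state c) (preUtils (received γ a i rest c)) := by
    intro c hc
    by_cases hca : c = a
    · subst hca
      exact .inr (.inr ⟨hready_a, hnil, by simp [hsdef]⟩)
    · rw [received_of_ne hca]
      exact (hγ.pre c i ((mem_children H).1 hc)).mono (Function.update_of_ne hca _ _) rfl
  by_cases hroot : i = H.tree.root ∧ Ready H s
  · obtain ⟨rfl, hready⟩ := hroot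
    have hidle : Idle H (γ.state H.tree.root) := hγ.root.idle_iff.2 hnot
    rw [preprocess_root hready] at hh
    have hpar : ∀ {p}, H.tree.parent H.tree.root = some p → False := by
      simp [H.tree.parent_root]
    have hutil' : UtilOK H { s with cpa := ∅, ub := ⊤, eval := true } :=
      ⟨hutil.pre, hutil.ctxtUtil⟩
    refine hγ.deliver_explore hm subset_rfl (extra := fun _ => []) (fun _ _ h => by cases h) hh
      (hutil'.searchOK_reset fun j hj => absurd hj (not_anc_root j)) (hγ.result _)
      ⟨hutil.pre, hutil.ctxtUtil⟩ (fun p hp => (hpar hp).elim) hdown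
      (fun p hp => (hpar hp).elim) ?_ (fun c hc h => absurd hc h) fun _ => ⟨hready, rfl, rfl⟩
    intro c hc _
    rcases hγ.link c _ ((mem_children H).1 hc) with ⟨-, h₁, h₂, h₃⟩ | ⟨d, _, hd, -⟩
    · rw [answers, filterMap_received hm rfl]
      exact ⟨h₁, h₂, h₃⟩
    · exact absurd hidle (not_idle_of_cur hc hd)
  · left
    rw [preprocess_of_ne fun h h' => hroot ⟨h, h'⟩] at hh
    refine hγ.deliver_quiet hm hh rfl rfl rfl hutil ?_ ?_ hdown ?_
    · intro y m hm
      split at hm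
      · obtain ⟨hy, rfl⟩ := mem_sendParent.1 hm
        exact ⟨⟨hy, hutil.preOut⟩, rfl, rfl⟩
      · cases hm
    · intro p hp
      rcases hγ.pre i p hp with ⟨-, h₁, h₂⟩ | ⟨h, -⟩ | ⟨h, -⟩
      · rw [preUtils_append, h₁, List.nil_append]
        by_cases hs : Ready H s
        · rw [if_pos hs, sendParent_parent hp]
          exact .inr (.inl ⟨hs, ⟨_, rfl⟩, h₂⟩)
        · rw [if_neg hs]
          exact .inl ⟨hs, rfl, h₂⟩
      · exact absurd h hnot
      · exact absurd h hnot
    · exact fun hi => ⟨fun h => absurd ⟨hi, h⟩ hroot, fun h => absurd h hnot⟩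

/-- The agent was idle, and so were its branches, when the CPA arrived; the edge to its parent passes
from the CPA being under way to the agent working on it or to its answer being under way. -/
theorem Searching.deliver_cpa [∀ j, Nonempty (D j)] (hγ : Searching H γ) {pa : Asg V D}
    {ub : ℝ≥0∞} {ev : Bool} (hm : γ.chan a i = .cpa pa ub ev :: rest) :
    Searching H (deliver H γ a i (.cpa pa ub ev) rest) ∨
      ∃ σ, H.dcop.IsOptimal σ ∧ Finished H σ (deliver H γ a i (.cpa pa ub ev) rest) := by
  have hia : H.tree.parent i = some a := hγ.msg a i (.cpa pa ub ev) (by simp [hm])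
  have hh : handle H (γ.state i) a (.cpa pa ub ev) = onCpa H (γ.state i) pa ub ev :=
    if_neg (not_not.2 (hγ.result i))
  have hlink := hγ.link i a hia
  rw [cpas, filterMap_eq_cons_received (f := Msg.getCpa) hm rfl] at hlink
  obtain ⟨d, hd, hpa, hub, hnil, hnil', hidle⟩ : ∃ d, (γ.state a).cur i = some d ∧
      pa = insert ⟨a, d⟩ (γ.state a).cpa ∧
      (LowerBound H i (insert ⟨a, d⟩ (γ.state a).cpa) ub → Dominated H (γ.state a) d) ∧
      cpas (received γ a i rest a) = [] ∧ answers (γ.chan i a) = [] ∧ Idle H (γ.state i) := by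
    rcases hlink with ⟨-, h, -⟩ | ⟨d, ub', hd, hub, ⟨h₁, h₂, h₃⟩ | ⟨h, -⟩ | ⟨h, -⟩⟩
    · cases h
    · obtain ⟨h, h'⟩ := List.cons.inj h₁
      cases h
      exact ⟨d, hd, rfl, hub, h', h₂, h₃⟩
    · cases h
    · cases h
  have hia' : i ∈ H.children a := (mem_children H).2 hia
  have hutil : UtilOK H (storeCpa H (γ.state i) pa ub ev) :=
    ⟨(hγ.util i).pre, (hγ.util i).ctxtUtil⟩
  have hanc : ∀ j, H.Anc j i → ∃ e, (⟨j, e⟩ : Σ j, D j) ∈ pa := by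
    intro j hj
    rw [hpa]
    obtain ⟨p, hp, hpj⟩ := Relation.TransGen.head'_iff.1 hj
    rw [hia] at hp
    cases hp
    rcases Relation.reflTransGen_iff_eq_or_transGen.1 hpj with rfl | hpj
    · exact ⟨d, Set.mem_insert _ _⟩
    · obtain ⟨e, he⟩ := (hγ.search a (not_idle_of_cur hia' hd)).anc j hpj
      exact ⟨e, Set.mem_insert_of_mem _ he⟩
  refine hγ.deliver_explore hm subset_rfl
    (s := resetSearch (storeCpa H (γ.state i) pa ub ev))
    (extra := fun j => if Finds H (γ.state i) pa ev then
      allocate H (storeCpa H (γ.state i) pa ub ev) j else [])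
    ?_ hh (hutil.searchOK_reset hanc) (hγ.result i) ⟨hutil.pre, hutil.ctxtUtil⟩
    (fun p hp => (hγ.pre i p hp).mono rfl rfl) ?_ ?_ ?_ (fun c hc h => absurd hc h) ?_
  · intro y m hm
    split at hm
    · exact mem_allocate hm
    · cases hm
  · intro c hc
    rw [preUtils, filterMap_received hm rfl]
    exact (hγ.pre c i ((mem_children H).1 hc)).mono rfl rfl
  · intro p hp
    rw [hia] at hp
    cases hp
    exact ⟨d, hd, hpa, hub, hnil, hnil'⟩
  · intro c hc _
    rw [answers, filterMap_received hm rfl]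
    rcases hγ.link c i ((mem_children H).1 hc) with ⟨-, h₁, h₂, h₃⟩ | ⟨d, _, hd, -⟩
    · exact ⟨h₁, h₂, h₃⟩
    · exact absurd hidle (not_idle_of_cur hc hd)
  · exact fun hi => absurd hi (H.tree.ne_root hia)

/-- By `Link`, the answer is right and belongs to the value being explored in that branch. -/
theorem Searching.deliver_backtrack [∀ j, Nonempty (D j)] (hγ : Searching H γ)
    {r : Option (ℝ≥0∞ × Asg V D)} (hm : γ.chan a i = .backtrack r :: rest) :
    Searching H (deliver H γ a i (.backtrack r) rest) ∨
      ∃ σ, H.dcop.IsOptimal σ ∧ Finished H σ (deliver H γ a i (.backtrack r) rest) := by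
  have hai : H.tree.parent a = some i := hγ.msg a i (.backtrack r) (by simp [hm])
  have hc : a ∈ H.children i := (mem_children H).2 hai
  have hh : handle H (γ.state i) a (.backtrack r) = onBacktrack H (γ.state i) a r :=
    if_neg (not_not.2 (hγ.result i))
  have hlink := hγ.link a i hai
  rw [answers, filterMap_eq_cons_received (f := Msg.getAnswer) hm rfl] at hlink
  obtain ⟨d, ub, hd, hub, hnil, hidle, hnil', hr⟩ : ∃ d ub, (γ.state i).cur a = some d ∧
      (LowerBound H a (insert ⟨i, d⟩ (γ.state i).cpa) ub → Dominated H (γ.state i) d) ∧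
      cpas (γ.chan i a) = [] ∧ Idle H (γ.state a) ∧ answers (received γ a i rest a) = [] ∧
      Answer H a (insert ⟨i, d⟩ (γ.state i).cpa) ub r := by
    rcases hlink with ⟨-, -, h, -⟩ | ⟨d, ub, hd, hub, ⟨-, h, -⟩ | ⟨-, h, -⟩ | ⟨h₁, h₂, x, h₃, h₄⟩⟩
    · cases h
    · cases h
    · cases h
    · obtain ⟨rfl, h⟩ := List.cons.inj h₃
      exact ⟨d, ub, hd, hub, h₁, h₂, h, h₄⟩
  rw [onBacktrack_eq hd] at hh
  have hactive := not_idle_of_cur hc hd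
  have hs := hγ.search i hactive
  have hsol := (hs.cur a hc (Finset.notMem_empty _) d hd).2
  refine hγ.deliver_explore hm (Finset.singleton_subset_iff.2 hc) (extra := fun _ => [])
    (fun _ _ h => by cases h) hh (hs.recordAnswer hc hd hub hr) (hγ.result i)
    ⟨(hγ.util i).pre, (hγ.util i).ctxtUtil⟩ (fun p hp => (hγ.pre i p hp).mono rfl rfl)
    ?_ ?_ ?_ ?_ ?_
  · intro c hc
    rw [preUtils, filterMap_received hm rfl]
    exact (hγ.pre c i ((mem_children H).1 hc)).mono rfl rfl
  · intro p hp
    rw [cpas, filterMap_received hm rfl]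
    rcases hγ.link i p hp with ⟨-, -, -, h⟩ | ⟨e, ub', he, hub', h | h | h⟩
    · exact absurd h hactive
    · exact absurd h.2.2 hactive
    · obtain ⟨h₁, h₂, -, h₃, rfl⟩ := h
      exact ⟨e, he, h₃, hub', h₁, h₂⟩
    · exact absurd h.2.1 hactive
  · intro c _ hca
    rw [Finset.mem_singleton] at hca
    subst hca
    exact ⟨hnil, hnil', hidle⟩
  · intro c hc' hca
    rw [Finset.mem_singleton] at hca
    rw [received_of_ne hca]
    exact (hγ.link c i ((mem_children H).1 hc')).mono rfl rfl
      (fun e he σ hσ => (upper_recordAnswer_le hc hsol r).trans (he σ hσ)) rfl rfl rfl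
  · rintro rfl
    exact ⟨not_not.1 fun h => hactive (hγ.root.idle_iff.2 h), hγ.root.cpa hactive,
      hγ.root.ub hactive⟩

theorem Searching.deliver [∀ j, Nonempty (D j)] (hγ : Searching H γ)
    (hm : γ.chan a i = m :: rest) : Searching H (deliver H γ a i m rest) ∨
      ∃ σ, H.dcop.IsOptimal σ ∧ Finished H σ (HSCAI.deliver H γ a i m rest) := by
  cases m with
  | preUtil sl w => exact hγ.deliver_preUtil hm
  | cpa pa ub ev => exact hγ.deliver_cpa hm
  | ctxt p => exact .inl (hγ.deliver_ctxt hm)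
  | ctxtUtil p w => exact .inl (hγ.deliver_ctxtUtil hm)
  | backtrack r => exact hγ.deliver_backtrack hm
  | terminate A => exact (hγ.msg a i (.terminate A) (by simp [hm])).elim

/-! ### Passing on the solution -/

theorem explore_of_ne_root (hi : i ≠ H.tree.root) {s : State V D i} {cs : Finset V}
    (hs : s.result = none) : (explore H s cs).1.result = none ∧
      ∀ y A, Msg.terminate A ∉ (explore H s cs).2 y := by
  have hni : i = H.tree.root → ¬ Idle H (advance H s cs).1 := fun h => absurd h hi
  refine ⟨?_, fun y A h => ?_⟩
  · rw [explore_of_ne hni]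
    exact hs
  · rcases mem_explore hni h with ⟨-, _, _, _, h⟩ | ⟨-, _, h⟩ <;> cases h

/-- An agent other than the root terminates only when it is told to. -/
theorem handle_of_ne_root (hi : i ≠ H.tree.root) {s : State V D i} (hs : s.result = none)
    (hm : ∀ A, m ≠ .terminate A) : (handle H s a m).1.result = none ∧
      ∀ y A, Msg.terminate A ∉ (handle H s a m).2 y := by
  cases m with
  | preUtil sl w =>
    rw [show handle H s a (.preUtil sl w) = preprocess H _ from if_neg (not_not.2 hs),
      preprocess_of_ne fun h => absurd h hi]
    refine ⟨hs, fun y A h => ?_⟩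
    dsimp only at h
    split at h
    · cases (mem_sendParent.1 h).2
    · cases h
  | cpa pa ub ev =>
    rw [show handle H s a (.cpa pa ub ev) = onCpa H s pa ub ev from if_neg (not_not.2 hs)]
    have := explore_of_ne_root hi (s := resetSearch (storeCpa H s pa ub ev))
      (cs := H.children i) hs
    refine ⟨this.1, fun y A h => ?_⟩
    rcases List.mem_append.1 h with h | h
    · split at h
      · obtain ⟨_, h⟩ := mem_allocate h
        cases h
      · cases h
    · exact this.2 y A h
  | ctxt p =>
    rw [show handle H s a (.ctxt p) = onCtxt H s p from if_neg (not_not.2 hs)]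
    refine ⟨hs, fun y A h => ?_⟩
    simp only [onCtxt] at h
    split at h
    · cases (mem_sendParent.1 h).2
    · obtain ⟨_, h⟩ := mem_allocate h
      cases h
  | ctxtUtil p w =>
    rw [show handle H s a (.ctxtUtil p w) = onCtxtUtil H s a p w from if_neg (not_not.2 hs)]
    refine ⟨hs, fun y A h => ?_⟩
    simp only [onCtxtUtil] at h
    split at h
    · cases (mem_sendParent.1 h).2
    · cases h
  | backtrack r =>
    rw [show handle H s a (.backtrack r) = onBacktrack H s a r from if_neg (not_not.2 hs)]
    cases hd : s.cur a with
    | none =>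
      simp only [onBacktrack, hd]
      exact ⟨hs, fun y A h => by cases h⟩
    | some d =>
      rw [onBacktrack_eq hd]
      exact explore_of_ne_root hi hs
  | terminate A => exact absurd rfl (hm A)

theorem Finished.deliver {σ : ∀ j, D j} (hγ : Finished H σ γ) (hm : γ.chan a i = m :: rest) :
    Finished H σ (deliver H γ a i m rest) := by
  -- What the reacting agent has to satisfy.
  suffices hreact : ∀ s out, handle H (γ.state i) a m = (s, out) →
      (s.result = (γ.state i).result ∨ i ≠ H.tree.root ∧ s.result = some (asg σ)) ∧
      (∀ y A, Msg.terminate A ∈ out y → A = asg σ) ∧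
      (s.result ≠ none → (γ.state i).result = none →
        ∀ c ∈ H.children i, Msg.terminate (asg σ) ∈ out c) ∧
      ((∃ A, m = .terminate A) → s.result ≠ none) by
    obtain ⟨hres, hmsg, hchild, hdone⟩ :=
      hreact (handle H (γ.state i) a m).1 (handle H (γ.state i) a m).2 rfl
    have hmono : ∀ j, (γ.state j).result ≠ none →
        ((HSCAI.deliver H γ a i m rest).state j).result ≠ none := by
      intro j hj
      by_cases hji : j = i
      · subst hji
        rw [deliver_state_self]
        rcases hres with h | ⟨-, h⟩
        · rwa [h]
        · simp [h]
      · rwa [deliver_state_of_ne hji]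
    refine ⟨?_, ?_, ?_, ?_⟩
    · by_cases hi : H.tree.root = i
      · subst hi
        rw [deliver_state_self, hres.resolve_right fun h => h.1 rfl, hγ.root]
      · rw [deliver_state_of_ne hi, hγ.root]
    · intro j
      by_cases hji : j = i
      · subst hji
        rw [deliver_state_self]
        rcases hres with h | ⟨-, h⟩
        · rw [h]
          exact hγ.result j
        · exact .inr h
      · rw [deliver_state_of_ne hji]
        exact hγ.result j
    · intro x y A hA
      rcases mem_deliver_chan hm hA with h | ⟨-, h⟩
      · exact hγ.msg x y A h
      · exact hmsg y A h
    · intro c p hcp hp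
      have hne := H.tree.parent_ne hcp
      by_cases hpold : (γ.state p).result = none
      · have hpi : p = i := by
          by_contra hpi
          rw [deliver_state_of_ne hpi] at hp
          exact hp hpold
        subst hpi
        rw [deliver_state_self] at hp
        rw [deliver_chan_out hne]
        exact .inr (List.mem_append_right _ (hchild hp hpold c (by simpa using hcp)))
      · rcases hγ.link c p hcp hpold with h | h
        · exact .inl (hmono c h)
        by_cases hci : c = i
        · subst hci
          by_cases hmt : Msg.terminate (asg σ) = m
          · left
            rw [deliver_state_self]
            exact hdone ⟨_, hmt.symm⟩
          · right
            rw [deliver_chan_in hne.symm]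
            exact mem_received_of_ne hm h hmt
        · right
          by_cases hpi : p = i
          · subst hpi
            rw [deliver_chan_out hne]
            exact List.mem_append_left _ h
          · rwa [deliver_chan_of_ne hpi hci]
  rintro s out hh
  by_cases hres : (γ.state i).result = none
  · have hi : i ≠ H.tree.root := by
      rintro rfl
      rw [hγ.root] at hres
      cases hres
    by_cases hmt : ∃ A, m = .terminate A
    · obtain ⟨A, rfl⟩ := hmt
      obtain rfl := hγ.msg a i A (by simp [hm])
      have h : handle H (γ.state i) a (.terminate (asg σ)) =
          ({ γ.state i with result := some (asg σ) },
            fun c => if c ∈ H.children i then [.terminate (asg σ)] else []) :=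
        if_neg (not_not.2 hres)
      rw [h] at hh
      cases hh
      refine ⟨.inr ⟨hi, rfl⟩, fun y A hA => ?_, fun _ _ c hc => ?_, fun _ => by simp⟩
      · dsimp only at hA
        split at hA
        · cases List.mem_singleton.1 hA
          rfl
        · cases hA
      · dsimp only
        rw [if_pos hc]
        exact List.mem_singleton_self _
    · push Not at hmt
      obtain ⟨h₁, h₂⟩ := handle_of_ne_root (a := a) hi hres hmt
      rw [hh] at h₁ h₂
      exact ⟨.inl (h₁.trans hres.symm), fun y A h => absurd h (h₂ y A), fun h => absurd h₁ h,
        fun ⟨A, h⟩ => absurd h (hmt A)⟩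
  · rw [handle_eq_self hres] at hh
    cases hh
    exact ⟨.inl rfl, fun y A h => (by cases h), fun _ h => absurd h hres, fun _ => hres⟩

/-! ### The first configuration -/

theorem utilOK_initial : UtilOK H (State.initial V D i) :=
  ⟨fun _ _ h => (by cases h), fun _ _ h => (by cases h)⟩

variable (H) in
theorem searching_or_finished_start [∀ j, Nonempty (D j)] :
    Searching H (start H) ∨ ∃ σ, H.dcop.IsOptimal σ ∧ Finished H σ (start H) := by
  have hstate : ∀ i, i ≠ H.tree.root → (start H).state i = State.initial V D i := by
    intro i hi
    simp only [start, preprocess_of_ne fun h => absurd h hi]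
  have hchan : ∀ i, i ≠ H.tree.root → ∀ y, ∀ m ∈ (start H).chan i y,
      H.tree.parent i = some y ∧ ∃ sl w, m = .preUtil sl w ∧ ValidUtil H i ∅ w := by
    intro i hi y m hm
    simp only [start, preprocess_of_ne fun h => absurd h hi] at hm
    split at hm
    · obtain ⟨hy, rfl⟩ := mem_sendParent.1 hm
      exact ⟨hy, _, _, rfl, utilOK_initial.preOut⟩
    · cases hm
  by_cases hready : Ready H (State.initial V D H.tree.root)
  · -- A root without children has solved the problem in its first move.
    right
    have hchildren : H.children H.tree.root = ∅ :=
      Finset.eq_empty_of_forall_notMem fun c hc => hready c hc rfl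
    have hutil : UtilOK H { State.initial V D H.tree.root with cpa := ∅, ub := ⊤, eval := true } :=
      ⟨fun _ _ h => (by cases h), fun _ _ h => (by cases h)⟩
    have hs := (hutil.searchOK_reset fun j hj => absurd hj (not_anc_root j)).advance
    have hidle : Idle H (advance H (resetSearch
        { State.initial V D H.tree.root with cpa := ∅, ub := ⊤, eval := true })
        (H.children H.tree.root)).1 := by
      intro c hc
      rw [hchildren] at hc
      exact absurd hc (Finset.notMem_empty c)
    obtain ⟨σ, v, hσ, hb⟩ := hs.exists_optimal hidle rfl rfl
    have hroot : preprocess H (State.initial V D H.tree.root) = _ :=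
      (preprocess_root hready).trans (explore_root hidle hb)
    refine ⟨σ, hσ, ?_, ?_, ?_, ?_⟩
    · simp only [start, hroot]
    · intro i
      by_cases hi : i = H.tree.root
      · subst hi
        right
        simp only [start, hroot]
      · rw [hstate i hi]
        exact .inl rfl
    · intro x y A hA
      by_cases hx : x = H.tree.root
      · subst hx
        simp only [start, hroot, List.mem_append] at hA
        rcases hA with h | h
        · obtain ⟨-, _, _, _, h⟩ := mem_advance h
          cases h
        · rw [hchildren, if_neg (Finset.notMem_empty y)] at h
          cases h
      · obtain ⟨-, _, _, h, -⟩ := hchan x hx y _ hA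
        cases h
    · intro c p hcp hp
      by_cases hpr : p = H.tree.root
      · subst hpr
        have : c ∈ H.children H.tree.root := by simpa using hcp
        rw [hchildren] at this
        exact absurd this (Finset.notMem_empty c)
      · rw [hstate p hpr] at hp
        exact absurd rfl hp
  · left
    have hroot := preprocess_of_ne (H := H) (s := State.initial V D H.tree.root) fun _ => hready
    have hstate : ∀ i, (start H).state i = State.initial V D i := by
      intro i
      by_cases hi : i = H.tree.root
      · subst hi
        simp only [start, hroot]
      · exact hstate i hi
    have hchan' : ∀ x y, ∀ m ∈ (start H).chan x y,
        H.tree.parent x = some y ∧ ∃ sl w, m = .preUtil sl w ∧ ValidUtil H x ∅ w := by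
      intro x y m hm
      by_cases hx : x = H.tree.root
      · subst hx
        simp only [start, hroot, hready, if_false] at hm
        cases hm
      · exact hchan x hx y m hm
    have hidle : ∀ i, Idle H (State.initial V D i) := fun _ _ _ => rfl
    constructor
    case result =>
      intro i
      rw [hstate]
      rfl
    case util =>
      intro i
      rw [hstate]
      exact utilOK_initial
    case msg =>
      intro x y m hm
      obtain ⟨hxy, _, _, rfl, hw⟩ := hchan' x y m hm
      exact ⟨hxy, hw⟩
    case pre =>
      intro c p hcp
      rw [hstate, hstate]
      simp only [start, preprocess_of_ne fun h => absurd h (H.tree.ne_root hcp)]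
      by_cases hc : Ready H (State.initial V D c)
      · rw [if_pos hc, sendParent_parent hcp]
        exact .inr (.inl ⟨hc, ⟨_, rfl⟩, rfl⟩)
      · rw [if_neg hc]
        exact .inl ⟨hc, rfl, rfl⟩
    case link =>
      intro c p hcp
      rw [hstate, hstate]
      refine .inl ⟨rfl, filterMap_eq_nil_of fun m hm => ?_, filterMap_eq_nil_of fun m hm => ?_,
        hidle c⟩
      all_goals
        obtain ⟨-, _, _, rfl, -⟩ := hchan' _ _ m hm
        rfl
    case search =>
      intro i hi
      rw [hstate] at hi
      exact absurd (hidle i) hi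
    case root =>
      rw [hstate]
      exact ⟨⟨fun _ => hready, fun _ => hidle _⟩, fun h => absurd (hidle _) h,
        fun h => absurd (hidle _) h⟩

/-! ### Configurations without messages -/

theorem searching_or_finished [∀ j, Nonempty (D j)]
    (h : Relation.ReflTransGen (Step H) (start H) γ) :
    Searching H γ ∨ ∃ σ, H.dcop.IsOptimal σ ∧ Finished H σ γ := by
  induction h with
  | refl => exact searching_or_finished_start H
  | tail _ hstep ih =>
    obtain ⟨a, b, m, rest, hm, rfl⟩ := hstep
    rcases ih with ih | ⟨σ, hσ, ih⟩
    · exact ih.deliver hm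
    · exact .inr ⟨σ, hσ, ih.deliver hm⟩

/-- The search does not come to a standstill: bottom-up, all agents would be ready and idle. -/
theorem Searching.exists_chan_ne_nil (hγ : Searching H γ) : ∃ a b, γ.chan a b ≠ [] := by
  by_contra! hnil
  have hready : ∀ i, Ready H (γ.state i) := fun i => by
    induction i using H.tree.wf_child.induction with
    | _ i ih =>
      intro c hc
      have hcp := (mem_children H).1 hc
      rcases hγ.pre c i hcp with ⟨h, -⟩ | ⟨-, ⟨x, h⟩, -⟩ | ⟨-, -, h⟩
      · exact absurd (ih c hcp) h
      · simp [hnil] at h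
      · exact h
  have hidle : ∀ i, Idle H (γ.state i) := fun i => by
    induction i using H.tree.wf_child.induction with
    | _ i ih =>
      intro c hc
      have hcp := (mem_children H).1 hc
      rcases hγ.link c i hcp with ⟨h, -⟩ | ⟨d, ub, -, -, ⟨h, -⟩ | ⟨-, -, h, -⟩ | ⟨-, -, x, h, -⟩⟩
      · exact h
      · simp [hnil] at h
      · exact absurd (ih c hcp) h
      · simp [hnil] at h
  exact hγ.root.idle_iff.1 (hidle _) (hready _)

theorem Finished.result_eq {σ : ∀ j, D j} (hγ : Finished H σ γ) (hnil : ∀ a b, γ.chan a b = [])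
    (i : V) : (γ.state i).result = some (asg σ) := by
  refine (hγ.result i).resolve_left ?_
  induction i using H.tree.wf_parent.induction with
  | _ i ih =>
    by_cases hi : i = H.tree.root
    · subst hi
      simp [hγ.root]
    · obtain ⟨p, hp⟩ := H.tree.exists_parent hi
      refine (hγ.link i p hp (ih p hp)).resolve_right ?_
      simp [hnil]

end Steps

section Termination

/-! ### Weights of messages -/

section Weights

variable {V : Type*} {D : V → Type*} [Fintype V] (H : Setup V D)

/-- Weights that grow towards the root. -/
theorem exists_weight_down (g : V → ℕ) (k : V → ℕ) :
    ∃ F : V → ℕ, ∀ i, F i = g i + ∑ c ∈ H.children i, k i * F c := by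
  let step (i : V) (F : ∀ c, H.tree.parent c = some i → ℕ) : ℕ :=
    g i + ∑ c ∈ (H.children i).attach, k i * F c.1 ((mem_children H).1 c.2)
  let F := H.tree.wf_child.fix step
  have hF : ∀ i, F i = step i fun c _ => F c := H.tree.wf_child.fix_eq step
  exact ⟨F, fun i => (hF i).trans (congrArg (g i + ·)
    (Finset.sum_attach (H.children i) fun c => k i * F c))⟩

/-- Weights that grow towards the leaves. -/
theorem exists_weight_up (g : V → ℕ) :
    ∃ F : V → ℕ, ∀ i, g i ≤ F i ∧ ∀ p, H.tree.parent i = some p → F i = g i + F p := by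
  let step (i : V) (F : ∀ p, H.tree.parent i = some p → ℕ) : ℕ :=
    g i + if h : ∃ p, H.tree.parent i = some p then F h.choose h.choose_spec else 0
  let F := H.tree.wf_parent.fix step
  have hF : ∀ i, F i = step i fun p _ => F p := H.tree.wf_parent.fix_eq step
  refine ⟨F, fun i => ⟨(Nat.le_add_right _ _).trans (hF i).ge, fun p hp => (hF i).trans ?_⟩⟩
  have h : ∃ p, H.tree.parent i = some p := ⟨p, hp⟩
  have hchoose : h.choose = p := Option.some.inj (h.choose_spec.symm.trans hp)
  simp only [step, dif_pos h, hchoose]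

variable [∀ j, Fintype (D j)]

/-- Weights of the messages, by kind and addressee: a message outweighs all that the addressee sends
in return, and a CPA or a preprocessing message also outweighs the search it may start. -/
structure Weights where
  terminate : V → ℕ
  backtrack : V → ℕ
  ctxtUtil : V → ℕ
  ctxt : V → ℕ
  cpa : V → ℕ
  preUtil : V → ℕ
  lt_terminate : ∀ i, ∑ c ∈ H.children i, terminate c < terminate i
  terminate_lt_backtrack : ∀ i, ∑ c ∈ H.children i, terminate c < backtrack i
  lt_backtrack : ∀ i p, H.tree.parent i = some p → backtrack p < backtrack i
  ctxtUtil_pos : ∀ i, 0 < ctxtUtil i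
  lt_ctxtUtil : ∀ i p, H.tree.parent i = some p → ctxtUtil p < ctxtUtil i
  le_ctxt : ∀ i, ctxtUtil i + ∑ c ∈ H.children i, ctxt c ≤ ctxt i
  le_cpa : ∀ i, backtrack i + ∑ c ∈ H.children i, ctxt c +
    ∑ c ∈ H.children i, Fintype.card (D i) * cpa c ≤ cpa i
  le_preUtil : ∀ i, backtrack i +
    ∑ c ∈ H.children i, Fintype.card (D i) * cpa c ≤ preUtil i
  lt_preUtil : ∀ i p, H.tree.parent i = some p → preUtil p < preUtil i

theorem nonempty_weights : Nonempty (Weights H) := by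
  obtain ⟨T, hT⟩ := exists_weight_down H (fun _ => 1) fun _ => 1
  obtain ⟨B, hB⟩ := exists_weight_up H fun i => 1 + ∑ c ∈ H.children i, T c
  obtain ⟨U, hU⟩ := exists_weight_up H fun _ => 1
  obtain ⟨X, hX⟩ := exists_weight_down H U fun _ => 1
  obtain ⟨C, hC⟩ := exists_weight_down H (fun i => B i + ∑ c ∈ H.children i, X c)
    fun i => Fintype.card (D i)
  obtain ⟨P, hP⟩ := exists_weight_up H fun i => 1 + (B i +
    ∑ c ∈ H.children i, Fintype.card (D i) * C c)
  simp only [one_mul] at hT hX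
  refine ⟨⟨T, B, U, X, C, P, fun i => ?_, fun i => ?_, fun i p h => ?_, fun i => ?_,
    fun i p h => ?_, fun i => ?_, fun i => ?_, fun i => ?_, fun i p h => ?_⟩⟩
  · have := hT i
    omega
  · have := (hB i).1
    omega
  · have := (hB i).2 p h
    omega
  · have := (hU i).1
    omega
  · have := (hU i).2 p h
    omega
  · exact (hX i).ge
  · exact (hC i).ge
  · have := (hP i).1
    omega
  · have := (hP i).2 p h
    omega

end Weights

variable {V : Type*} {D : V → Type*} [Fintype V] [∀ j, Fintype (D j)] [∀ j, LinearOrder (D j)]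
variable {H : Setup V D} (W : Weights H) {i : V}

/-- The weight of a message to `b`. -/
def Weights.msg (b : V) : Msg V D → ℕ
  | .preUtil _ _ => W.preUtil b
  | .cpa _ _ _ => W.cpa b
  | .ctxt _ => W.ctxt b
  | .ctxtUtil _ _ => W.ctxtUtil b
  | .backtrack _ => W.backtrack b
  | .terminate _ => W.terminate b

/-- The weight of a queue to `b`. -/
def Weights.queue (b : V) (l : List (Msg V D)) : ℕ := (l.map (W.msg b)).sum

/-- The weight of outgoing messages. -/
noncomputable def Weights.out (o : Out V D) : ℕ := ∑ y, W.queue y (o y)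

/-- The weight of the CPAs that an agent can still send under its present CPA. -/
noncomputable def Weights.state (s : State V D i) : ℕ :=
  ∑ c ∈ H.children i, (Finset.univ \ s.tried c).card * W.cpa c

/-- The weight of a configuration. It decreases with every step. -/
noncomputable def Weights.config (γ : Config V D) : ℕ :=
  ∑ i, W.state (γ.state i) + ∑ a, ∑ b, W.queue b (γ.chan a b)

theorem Weights.queue_append (b : V) (l l' : List (Msg V D)) :
    W.queue b (l ++ l') = W.queue b l + W.queue b l' := by
  simp [Weights.queue]

theorem Weights.out_append (o o' : Out V D) :
    W.out (fun y => o y ++ o' y) = W.out o + W.out o' := by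
  simp [Weights.out, Weights.queue_append, Finset.sum_add_distrib]

theorem Weights.out_silent : W.out (silent : Out V D) = 0 := by
  simp [Weights.out, silent, Weights.queue]

/-- Weight of messages sent to a set of agents. -/
theorem Weights.out_ite (cs : Finset V) (o : Out V D) :
    W.out (fun y => if y ∈ cs then o y else []) = ∑ y ∈ cs, W.queue y (o y) := by
  rw [Weights.out, ← Finset.sum_filter_add_sum_filter_not Finset.univ (· ∈ cs)]
  rw [Finset.sum_congr rfl (g := fun y => W.queue y (o y)),
    Finset.sum_congr (s₁ := Finset.univ.filter (· ∉ cs)) rfl (g := fun _ => 0)]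
  · simp
  · intro y hy
    simp [(Finset.mem_filter.1 hy).2, Weights.queue]
  · intro y hy
    simp [(Finset.mem_filter.1 hy).2]

theorem Weights.out_terminate (A : Asg V D) :
    W.out (fun y => if y ∈ H.children i then [Msg.terminate A] else []) =
      ∑ c ∈ H.children i, W.terminate c := by
  rw [W.out_ite (H.children i) fun _ => [Msg.terminate A]]
  simp [Weights.queue, Weights.msg]

theorem Weights.out_sendParent_le {m : Msg V D} {n : ℕ}
    (h : ∀ p, H.tree.parent i = some p → W.msg p m ≤ n) : W.out (sendParent H i m) ≤ n := by
  unfold sendParent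
  cases hp : H.tree.parent i with
  | none => simp [Weights.out_silent]
  | some p =>
    have : (sendTo p m : Out V D) = fun y => if y ∈ ({p} : Finset V) then [m] else [] := by
      funext y
      simp [sendTo]
    dsimp only
    rw [this, W.out_ite {p} fun _ => [m]]
    simpa [Weights.queue] using h p hp

theorem Weights.out_allocate_le (s : State V D i) :
    W.out (allocate H s) ≤ ∑ c ∈ H.children i, W.ctxt c := by
  unfold allocate
  rw [W.out_ite (inferChild H s) fun c => [Msg.ctxt (alloc s c)]]
  simp only [Weights.queue, Weights.msg, List.map_cons, List.map_nil, List.sum_cons, List.sum_nil,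
    add_zero]
  exact Finset.sum_le_sum_of_subset (Finset.filter_subset _ _)

theorem Weights.state_le (s : State V D i) :
    W.state s ≤ ∑ c ∈ H.children i, Fintype.card (D i) * W.cpa c :=
  Finset.sum_le_sum fun _ _ => Nat.mul_le_mul_right _ (Finset.card_le_univ _)

/-- A CPA is paid for by the value that becomes a tried one. -/
theorem Weights.advance_le (s : State V D i) {cs : Finset V} (hcs : cs ⊆ H.children i) :
    W.state (advance H s cs).1 + W.out (advance H s cs).2 ≤ W.state s := by
  simp only [advance]
  rw [W.out_ite cs, ← Finset.inter_eq_right.2 hcs, ← Finset.sum_ite_mem, Weights.state,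
    ← Finset.sum_add_distrib]
  refine Finset.sum_le_sum fun c hc => ?_
  simp only [Finset.mem_inter, hc, true_and]
  by_cases hccs : c ∈ cs
  · cases hn : nextVal H s c with
    | none => simp [hccs, Weights.queue]
    | some d =>
      have hd : d ∈ Finset.univ \ s.tried c := by simpa using (nextVal_eq_some hn).1
      have : Finset.univ \ (s.tried c ∪ {d}) = (Finset.univ \ s.tried c).erase d := by
        ext e
        simp
      simp only [hccs, if_true, Option.toFinset_some, this, Weights.queue, List.map_cons,
        List.map_nil, List.sum_cons, List.sum_nil, Weights.msg, add_zero]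
      rw [← Nat.succ_mul, Nat.succ_eq_add_one, Finset.card_erase_add_one hd]
  · simp [hccs]

theorem Weights.conclude_lt (s : State V D i) :
    W.state (conclude H s).1 + W.out (conclude H s).2 < W.state s + W.backtrack i := by
  have hT := W.terminate_lt_backtrack i
  unfold conclude
  split
  · split
    · split
      · rw [W.out_terminate]
        exact Nat.add_lt_add_left hT _
      · rw [W.out_silent]
        dsimp only
        omega
    · refine Nat.add_lt_add_left
        (Nat.lt_of_le_pred (by omega) (W.out_sendParent_le fun p hp => ?_)) _
      exact Nat.le_pred_of_lt (W.lt_backtrack i p hp)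
  · rw [W.out_silent]
    dsimp only
    omega

theorem Weights.explore_lt (s : State V D i) {cs : Finset V} (hcs : cs ⊆ H.children i) :
    W.state (explore H s cs).1 + W.out (explore H s cs).2 < W.state s + W.backtrack i := by
  have h₁ := W.advance_le s hcs
  have h₂ := W.conclude_lt (advance H s cs).1
  simp only [explore, W.out_append]
  omega

theorem Weights.startSearch_lt (s : State V D i) :
    W.state (startSearch H s).1 + W.out (startSearch H s).2 <
      W.backtrack i + ∑ c ∈ H.children i, Fintype.card (D i) * W.cpa c := by
  have h₁ := W.explore_lt (resetSearch s) (subset_refl (H.children i))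
  have h₂ := W.state_le (resetSearch s)
  rw [startSearch_eq]
  omega

theorem Weights.preprocess_lt (s : State V D i) :
    W.state (preprocess H s).1 + W.out (preprocess H s).2 < W.state s + W.preUtil i := by
  have h := W.le_preUtil i
  have hT := W.terminate_lt_backtrack i
  unfold preprocess
  split
  · split
    · have := W.startSearch_lt { s with cpa := ∅, ub := ⊤, eval := true }
      omega
    · refine Nat.add_lt_add_left
        (Nat.lt_of_le_pred (by omega) (W.out_sendParent_le fun p hp => ?_)) _
      exact Nat.le_pred_of_lt (W.lt_preUtil i p hp)
  · rw [W.out_silent]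
    dsimp only
    omega

theorem Weights.handle_lt {s : State V D i} (hs : ∀ c, s.cur c ≠ none → c ∈ H.children i) (a : V)
    (m : Msg V D) :
    W.state (handle H s a m).1 + W.out (handle H s a m).2 < W.state s + W.msg i m := by
  have hT := W.lt_terminate i
  have hB := W.terminate_lt_backtrack i
  have hU := W.ctxtUtil_pos i
  have hX := W.le_ctxt i
  have hC := W.le_cpa i
  have hP := W.le_preUtil i
  unfold handle
  split
  · have : 0 < W.msg i m := by
      cases m <;> simp only [Weights.msg] <;> omega
    rw [W.out_silent]
    dsimp only
    omega
  cases m with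
  | preUtil sl w => exact W.preprocess_lt _
  | cpa pa ub ev =>
    have h₁ := W.startSearch_lt (storeCpa H s pa ub ev)
    have h₂ : W.out (fun j => if Finds H s pa ev then allocate H (storeCpa H s pa ub ev) j else [])
        ≤ ∑ c ∈ H.children i, W.ctxt c := by
      by_cases h : Finds H s pa ev
      · simp only [h, if_true]
        exact W.out_allocate_le _
      · simp only [h, if_false]
        exact W.out_silent.trans_le (Nat.zero_le _)
    simp only [onCpa, W.out_append, Weights.msg]
    omega
  | ctxt p =>
    refine Nat.add_lt_add_left ?_ (W.state s)
    dsimp only [onCtxt, Weights.msg]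
    split
    · refine (Nat.lt_of_le_pred hU (W.out_sendParent_le fun p hp => ?_)).trans_le (by omega)
      exact Nat.le_pred_of_lt (W.lt_ctxtUtil i p hp)
    · have := W.out_allocate_le { s with ctxt := p, starter := false, eval := false }
      omega
  | ctxtUtil p w =>
    refine Nat.add_lt_add_left ?_ (W.state s)
    dsimp only [onCtxtUtil, Weights.msg]
    split
    · refine Nat.lt_of_le_pred hU (W.out_sendParent_le fun p hp => ?_)
      exact Nat.le_pred_of_lt (W.lt_ctxtUtil i p hp)
    · rwa [W.out_silent]
  | backtrack r =>
    dsimp only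
    cases hd : s.cur a with
    | none =>
      simp only [onBacktrack, hd, W.out_silent, Weights.msg]
      omega
    | some d =>
      rw [onBacktrack_eq hd]
      exact W.explore_lt (recordAnswer s a d r)
        (Finset.singleton_subset_iff.2 (hs a (by simp [hd])))
  | terminate A =>
    rw [W.out_terminate]
    exact Nat.add_lt_add_left hT (W.state s)

theorem Weights.deliver_lt {γ : Config V D} {a : V} {m : Msg V D} {rest : List (Msg V D)}
    (hm : γ.chan a i = m :: rest) (hγ : ∀ c, (γ.state i).cur c ≠ none → c ∈ H.children i) :
    W.config (deliver H γ a i m rest) < W.config γ := by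
  have h := W.handle_lt hγ a m
  have hstate : ∑ j, W.state ((deliver H γ a i m rest).state j) + W.state (γ.state i) =
      ∑ j, W.state (γ.state j) + W.state (handle H (γ.state i) a m).1 := by
    rw [← Finset.add_sum_erase _ _ (Finset.mem_univ i),
      ← Finset.add_sum_erase _ (fun j => W.state (γ.state j)) (Finset.mem_univ i),
      deliver_state_self, Finset.sum_congr rfl (g := fun j => W.state (γ.state j))]
    · omega
    · intro j hj
      rw [deliver_state_of_ne (Finset.ne_of_mem_erase hj)]
  have hqueue : ∀ x y, W.queue y ((deliver H γ a i m rest).chan x y) +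
      (if x = a then if y = i then W.msg i m else 0 else 0) =
      W.queue y (γ.chan x y) +
        if x = i then W.queue y ((handle H (γ.state i) a m).2 y) else 0 := by
    intro x y
    simp only [deliver, Weights.queue_append]
    have h₁ : W.queue y (if x = a ∧ y = i then rest else γ.chan x y) +
        (if x = a then if y = i then W.msg i m else 0 else 0) = W.queue y (γ.chan x y) := by
      by_cases hx : x = a
      · by_cases hy : y = i
        · subst hx hy
          simp only [and_self, if_true, hm, Weights.queue, List.map_cons, List.sum_cons]
          omega
        · simp [hy]
      · simp [hx]
    have h₂ : W.queue y (if x = i then (handle H (γ.state i) a m).2 y else []) =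
        if x = i then W.queue y ((handle H (γ.state i) a m).2 y) else 0 := by
      split <;> simp [Weights.queue]
    omega
  have hsum := Finset.sum_congr rfl fun x (_ : x ∈ Finset.univ) =>
    Finset.sum_congr rfl fun y (_ : y ∈ Finset.univ) => hqueue x y
  have hout : ∑ x, ∑ y, (if x = i then W.queue y ((handle H (γ.state i) a m).2 y) else 0) =
      W.out (handle H (γ.state i) a m).2 := by
    rw [Finset.sum_comm]
    simp [Weights.out]
  have hin : ∑ x, ∑ y, (if x = a then if y = i then W.msg i m else 0 else 0) = W.msg i m := by
    rw [Finset.sum_comm]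
    simp
  simp only [Finset.sum_add_distrib] at hsum
  rw [hout, hin] at hsum
  unfold Weights.config
  omega

/-! ### Only branches are explored -/

variable (H) in
/-- Only branches are being explored. -/
def CurOK (s : State V D i) : Prop := ∀ c, s.cur c ≠ none → c ∈ H.children i

theorem CurOK.explore {s : State V D i} {cs : Finset V} (hs : CurOK H s)
    (hcs : cs ⊆ H.children i) : CurOK H (explore H s cs).1 := by
  have h : (HSCAI.explore H s cs).1.cur = (advance H s cs).1.cur := by
    simp only [HSCAI.explore, conclude]
    split
    · split
      · split <;> rfl
      · rfl
    · rfl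
  intro c hc
  rw [h] at hc
  simp only [advance] at hc
  split at hc
  · exact hcs ‹_›
  · exact hs c hc

theorem curOK_resetSearch (s : State V D i) : CurOK H (resetSearch s) :=
  fun _ h => absurd rfl h

theorem CurOK.preprocess {s : State V D i} (hs : CurOK H s) : CurOK H (preprocess H s).1 := by
  unfold HSCAI.preprocess
  split
  · split
    · exact (curOK_resetSearch _).explore subset_rfl
    · exact hs
  · exact hs

theorem CurOK.handle {s : State V D i} (hs : CurOK H s) (a : V) (m : Msg V D) :
    CurOK H (handle H s a m).1 := by
  unfold HSCAI.handle
  split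
  · exact hs
  cases m with
  | preUtil sl w => exact CurOK.preprocess hs
  | cpa pa ub ev => exact (curOK_resetSearch _).explore subset_rfl
  | ctxt p => exact hs
  | ctxtUtil p w => exact hs
  | backtrack r =>
    dsimp only
    cases hd : s.cur a with
    | none =>
      simp only [onBacktrack, hd]
      exact hs
    | some d =>
      rw [onBacktrack_eq hd]
      exact CurOK.explore hs (Finset.singleton_subset_iff.2 (hs a (by simp [hd])))
  | terminate A => exact hs

variable (H) in
theorem no_infinite_run : ¬ ∃ run : ℕ → Config V D,
    run 0 = start H ∧ ∀ n, Step H (run n) (run (n + 1)) := by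
  rintro ⟨run, h0, hstep⟩
  obtain ⟨W⟩ := nonempty_weights H
  have hcur : ∀ n i, CurOK H ((run n).state i) := by
    intro n
    induction n with
    | zero =>
      intro i
      rw [h0]
      exact CurOK.preprocess fun _ h => absurd rfl h
    | succ n ih =>
      intro i
      obtain ⟨a, b, m, rest, -, h⟩ := hstep n
      rw [h]
      by_cases hi : i = b
      · subst hi
        rw [deliver_state_self]
        exact (ih i).handle a m
      · rw [deliver_state_of_ne hi]
        exact ih i
  refine not_strictAnti_of_wellFoundedLT (fun n => W.config (run n))
    (strictAnti_nat_of_succ_lt fun n => ?_)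
  obtain ⟨a, b, m, rest, hm, h⟩ := hstep n
  rw [h]
  exact W.deliver_lt hm (hcur n b)

end Termination

end HSCAI

theorem theorem1 {V : Type*} {D : V → Type*} [Fintype V] [∀ j, Fintype (D j)]
    [∀ j, LinearOrder (D j)] [∀ j, Nonempty (D j)] (H : HSCAI.Setup V D) :
    (¬ ∃ run : ℕ → HSCAI.Config V D,
        run 0 = HSCAI.start H ∧ ∀ n, HSCAI.Step H (run n) (run (n + 1))) ∧
    (∀ γ, Relation.ReflTransGen (HSCAI.Step H) (HSCAI.start H) γ →
      (¬ ∃ γ', HSCAI.Step H γ γ') →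
      ∃ σ : ∀ j, D j, H.dcop.IsOptimal σ ∧
        ∀ i, (γ.state i).result = some (HSCAI.asg σ)) := by
  refine ⟨HSCAI.no_infinite_run H, fun γ hγ hstuck => ?_⟩
  have hnil : ∀ a b, γ.chan a b = [] := by
    intro a b
    by_contra hne
    obtain ⟨m, rest, h⟩ := List.exists_cons_of_ne_nil hne
    exact hstuck ⟨_, a, b, m, rest, h, rfl⟩
  rcases HSCAI.searching_or_finished hγ with h | ⟨σ, hσ, h⟩
  · obtain ⟨a, b, hab⟩ := h.exists_chan_ne_nil
    exact absurd (hnil a b) hab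
  · exact ⟨σ, hσ, h.result_eq hnil⟩
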